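/- For $n\in\mathbb N=\{0,1,2,\dots\}$ identify $\mathbb C^{2^n}$ with $(\mathbb C^2)^{\otimes n}$. A \emph{state} is a sequence $\rho=(\rho_n)_{n\in\mathbb N}$ of density matrices (positive semidefinite, trace one) $\rho_n\in\mathbb C^{2^n\times 2^n}$ such that, for every $n$, the partial trace of $\rho_{n+1}$ over the last qubit is $\rho_n$. The state $\tau$ is given by $\tau_n=2^{-n}I$. A \emph{special projection} is a Hermitian projection matrix with complex algebraic entries; special projections are coded by natural numbers through a standard computable presentation of the complex algebraic numbers (a code of an algebraic number is a nonzero integer polynomial together with a closed disc, given by rational data, in which the number is the only root of the polynomial; a code of a matrix is the list of its rows, each a list of codes of its entries). A \emph{quantum $\Sigma^0_1$ set} is a computable sequence $G=(p_n)_{n\in\mathbb N}$ of special projections, $p_n$ of size $2^n\times 2^n$, with $\operatorname{range}(p_n\otimes I_2)\subseteq\operatorname{range}(p_{n+1})$ for all $n$; for a state $\rho$ put $\rho(G)=\lim_n\operatorname{Tr}(\rho_np_n)$ (the limit exists and lies in $[0,1]$). A sequence $(S^m)_{m\in\mathbb N}$ of quantum $\Sigma^0_1$ sets $S^m=(S^m_n)_n$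 is \emph{uniformly computable} if one computable function maps each $(m,n)$ to a code of $S^m_n$. A \emph{quantum Martin-L\"of test} is a uniformly computable sequence $(S^m)_{m\in\mathbb N}$ of quantum $\Sigma^0_1$ sets with $\tau(S^m)\le 2^{-m}$ for all $m$; a state $\rho$ is \emph{quantum Martin-L\"of random} if $\inf_m\rho(S^m)=0$ for every such test. A \emph{quantum Solovay test} is a uniformly computable sequence $(S^k)_{k\in\mathbb N}$ of quantum $\Sigma^0_1$ sets with $\sum_k\tau(S^k)<\infty$; a state $\rho$ is \emph{quantum Solovay random} if, for every such test and every $\delta>0$, there are only finitely many $k$ with $\rho(S^k)>\delta$. \textbf{Theorem.} A state is quantum Solovay random if and only if it is quantum Martin-L\"of random. -/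

import Mathlib

open Matrix Filter Topology
open scoped Kronecker ComplexOrder

noncomputable section

namespace QRand

/-! ### Qubits: tensoring with one more qubit, and tracing out the last qubit

A `2 ^ n × 2 ^ n` matrix acts on `n` qubits. The basis vector number `b + 2 * i` of `n + 1` qubits
is `|i⟩ ⊗ |b⟩`: the last qubit is the least significant binary digit. -/

/-- Square complex matrices of size `2 ^ n`, the operators on `n` qubits. -/
abbrev QMat (n : ℕ) : Type := Matrix (Fin (2 ^ n)) (Fin (2 ^ n)) ℂ

/-- The index of `|i⟩ ⊗ |b⟩`. -/
def snocEquiv (n : ℕ) : Fin (2 ^ n) × Fin 2 ≃ Fin (2 ^ (n + 1)) :=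
  finProdFinEquiv.trans (finCongr (pow_succ 2 n).symm)

/-- `A ⊗ I`, with `I` the identity of the last qubit. -/
def tensorId {n : ℕ} (A : QMat n) : QMat (n + 1) :=
  Matrix.reindex (snocEquiv n) (snocEquiv n) (A ⊗ₖ (1 : Matrix (Fin 2) (Fin 2) ℂ))

/-- The partial trace over the last qubit. -/
def partialTrace {n : ℕ} (A : QMat (n + 1)) : QMat n :=
  fun i j => ∑ b : Fin 2, A (snocEquiv n (i, b)) (snocEquiv n (j, b))

/-- A density matrix: positive semidefinite of trace one. -/
structure IsDensityMatrix {n : ℕ} (A : QMat n) : Prop where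
  posSemidef : A.PosSemidef
  trace_eq_one : A.trace = 1

/-- A state: a sequence of density matrices, coherent under the partial trace. -/
structure State where
  mat : (n : ℕ) → QMat n
  density : ∀ n, IsDensityMatrix (mat n)
  coherent : ∀ n, partialTrace (mat (n + 1)) = mat n

/-- The tracial state `τ`, with `τ_n = 2⁻ⁿ I`. -/
def tracialState : State where
  mat n := ((2 : ℂ) ^ n)⁻¹ • (1 : QMat n)
  density n := by
    refine ⟨Matrix.PosSemidef.one.smul ?_, ?_⟩
    · simp
    · simp [Matrix.trace_smul, Matrix.trace_one]
  coherent n := by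
    ext i j
    by_cases h : i = j
    · subst h
      simp [partialTrace, pow_succ]
    · simp [partialTrace, h]

/-! ### Codes of algebraic numbers and of matrices of algebraic numbers -/

/-- A code of a complex algebraic number: the list of the coefficients (constant term first) of an
integer polynomial, and integers `a`, `b`, `k` that describe the closed disc with centre
`(a + b i) / (k + 1)` and radius `1 / (k + 1)`. -/
abbrev AlgCode : Type := List ℤ × (ℤ × ℤ) × ℕ

/-- The integer polynomial with a given list of coefficients, constant term first. -/
def polyOfList : List ℤ → Polynomial ℤ
  | [] => 0
  | a :: l => Polynomial.C a + Polynomial.X * polyOfList l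

/-- The closed disc that is described by a code. -/
def AlgCode.disc (c : AlgCode) : Set ℂ :=
  Metric.closedBall (((c.2.1.1 : ℂ) + (c.2.1.2 : ℂ) * Complex.I) / ((c.2.2 : ℂ) + 1))
    (1 / ((c.2.2 : ℝ) + 1))

/-- `c` is a code of `z`: the polynomial of `c` is nonzero, and `z` is its one and only root in the
disc of `c`. A complex number has a code if and only if it is algebraic. -/
def AlgCode.Represents (c : AlgCode) (z : ℂ) : Prop :=
  polyOfList c.1 ≠ 0 ∧ Polynomial.aeval z (polyOfList c.1) = 0 ∧ z ∈ c.disc ∧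
    ∀ w ∈ c.disc, Polynomial.aeval w (polyOfList c.1) = 0 → w = z

/-- A code of a matrix of algebraic numbers: the list of its rows, each the list of codes of its
entries. Through the standard encoding of `ℤ`, of pairs and of lists it is a natural number. -/
abbrev MatrixCode : Type := List (List AlgCode)

/-- `rows` is a code of the matrix `A`. -/
def MatrixCode.Represents (rows : MatrixCode) {N : ℕ} (A : Matrix (Fin N) (Fin N) ℂ) : Prop :=
  rows.length = N ∧ (∀ row ∈ rows, row.length = N) ∧
    ∀ i j : Fin N, ∃ row, rows[(i : ℕ)]? = some row ∧
      ∃ a, row[(j : ℕ)]? = some a ∧ AlgCode.Represents a (A i j)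

/-! ### Quantum `Σ⁰₁` sets -/

/-- A special projection: a Hermitian projection with complex algebraic entries. -/
structure IsSpecialProjection {n : ℕ} (p : QMat n) : Prop where
  isHermitian : p.IsHermitian
  isIdempotent : p * p = p
  isAlgebraic : ∀ i j, IsAlgebraic ℚ (p i j)

/-- A quantum `Σ⁰₁` set: a computable sequence of special projections `p_i`, of size `2 ^ i`, with
`range (p_i ⊗ I) ⊆ range p_{i+1}`. -/
structure QSigmaSet where
  proj : (n : ℕ) → QMat n
  special : ∀ n, IsSpecialProjection (proj n)
  nested : ∀ n, LinearMap.range (Matrix.mulVecLin (tensorId (proj n))) ≤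
    LinearMap.range (Matrix.mulVecLin (proj (n + 1)))
  computable : ∃ f : ℕ → MatrixCode, Computable f ∧
    ∀ n, MatrixCode.Represents (f n) (proj n)

/-- `ρ(G) = lim_n Tr (ρ_n p_n)` for a state `ρ` and a quantum `Σ⁰₁` set `G = (p_n)`.
The limit always exists and the traces are real: see `State.tendsto_value`. -/
def State.value (ρ : State) (G : QSigmaSet) : ℝ :=
  limUnder atTop (fun n => (Matrix.trace (ρ.mat n * G.proj n)).re)

/-- A (uniformly) computable sequence of quantum `Σ⁰₁` sets: one computable function gives the
`n`-th projection of the `m`-th set from `m` and `n`. -/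
def IsComputableSeq (S : ℕ → QSigmaSet) : Prop :=
  ∃ f : ℕ × ℕ → MatrixCode, Computable f ∧
    ∀ m n, MatrixCode.Represents (f (m, n)) ((S m).proj n)

/-! ### The two randomness notions -/

/-- A quantum Martin-Löf test. -/
structure IsQMLTest (S : ℕ → QSigmaSet) : Prop where
  computable : IsComputableSeq S
  bound : ∀ m, tracialState.value (S m) ≤ (2 : ℝ)⁻¹ ^ m

/-- A state is quantum Martin-Löf random if `inf_m ρ(S_m) = 0` for every quantum Martin-Löf test.
(The values lie in `[0, 1]`: see `State.value_mem_Icc`.) -/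
def State.IsQMLRandom (ρ : State) : Prop :=
  ∀ S : ℕ → QSigmaSet, IsQMLTest S → ⨅ m, ρ.value (S m) = 0

/-- A quantum Solovay test. -/
structure IsQSolovayTest (S : ℕ → QSigmaSet) : Prop where
  computable : IsComputableSeq S
  summable : Summable fun k => tracialState.value (S k)

/-- `ρ` fails the sequence `S` at level `δ`: `ρ(S_k) > δ` for infinitely many `k`. -/
def State.FailsSolovayAt (ρ : State) (S : ℕ → QSigmaSet) (δ : ℝ) : Prop :=
  {k : ℕ | δ < ρ.value (S k)}.Infinite

/-- `ρ` passes the sequence `S`: it fails it at no level `δ > 0`. -/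
def State.PassesSolovay (ρ : State) (S : ℕ → QSigmaSet) : Prop :=
  ∀ δ : ℝ, 0 < δ → ¬ ρ.FailsSolovayAt S δ

/-- A state is quantum Solovay random if it passes every quantum Solovay test. -/
def State.IsQSolovayRandom (ρ : State) : Prop :=
  ∀ S : ℕ → QSigmaSet, IsQSolovayTest S → ρ.PassesSolovay S

/-! ### The limit that defines `ρ(G)` exists -/

theorem trace_mul_nonneg {n : ℕ} {A X : QMat n} (hA : A.PosSemidef) (hX : X.IsHermitian)
    (hXX : X * X = X) : 0 ≤ Matrix.trace (A * X) := by
  have h := (hA.mul_mul_conjTranspose_same X).trace_nonneg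
  rw [hX.eq, Matrix.mul_assoc, Matrix.trace_mul_comm, Matrix.mul_assoc, hXX] at h
  exact h

theorem trace_mul_tensorId {n : ℕ} (A : QMat (n + 1)) (p : QMat n) :
    Matrix.trace (A * tensorId p) = Matrix.trace (partialTrace A * p) := by
  simp only [Matrix.trace, Matrix.diag, Matrix.mul_apply, partialTrace]
  rw [← (snocEquiv n).sum_comp, Fintype.sum_prod_type]
  refine Finset.sum_congr rfl fun i _ => ?_
  have key : ∀ b : Fin 2, ∑ j, A (snocEquiv n (i, b)) j * tensorId p j (snocEquiv n (i, b)) =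
      ∑ j, A (snocEquiv n (i, b)) (snocEquiv n (j, b)) * p j i := by
    intro b
    rw [← (snocEquiv n).sum_comp, Fintype.sum_prod_type]
    refine Finset.sum_congr rfl fun j _ => ?_
    simp [tensorId, Matrix.one_apply]
  simp only [key]
  rw [Finset.sum_comm]
  simp only [Finset.sum_mul]

theorem tensorId_isHermitian {n : ℕ} {p : QMat n} (hp : p.IsHermitian) :
    (tensorId p).IsHermitian := by
  unfold tensorId Matrix.IsHermitian
  rw [Matrix.conjTranspose_reindex, Matrix.conjTranspose_kronecker, hp.eq,
    Matrix.conjTranspose_one]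

theorem tensorId_mul {n : ℕ} (p q : QMat n) : tensorId p * tensorId q = tensorId (p * q) := by
  unfold tensorId
  rw [Matrix.reindex_apply, Matrix.reindex_apply, Matrix.reindex_apply,
    Matrix.submatrix_mul_equiv, ← Matrix.mul_kronecker_mul, Matrix.one_mul]

theorem mul_eq_of_range_le {N : ℕ} {P q : Matrix (Fin N) (Fin N) ℂ} (hq : q * q = q)
    (h : LinearMap.range (Matrix.mulVecLin P) ≤ LinearMap.range (Matrix.mulVecLin q)) :
    q * P = P := by
  refine Matrix.ext_of_mulVec_single fun i => ?_
  obtain ⟨w, hw⟩ := h ⟨Pi.single i 1, rfl⟩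
  simp only [Matrix.mulVecLin_apply] at hw
  rw [← Matrix.mulVec_mulVec, ← hw, Matrix.mulVec_mulVec, hq]

theorem State.trace_mem (ρ : State) (G : QSigmaSet) (n : ℕ) :
    0 ≤ Matrix.trace (ρ.mat n * G.proj n) ∧ Matrix.trace (ρ.mat n * G.proj n) ≤ 1 := by
  have hG := G.special n
  refine ⟨trace_mul_nonneg (ρ.density n).posSemidef hG.isHermitian hG.isIdempotent, ?_⟩
  have h := trace_mul_nonneg (ρ.density n).posSemidef
    (Matrix.isHermitian_one.sub hG.isHermitian)
    (by simp [Matrix.mul_sub, Matrix.sub_mul, hG.isIdempotent])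
  rw [Matrix.mul_sub, Matrix.mul_one, Matrix.trace_sub, (ρ.density n).trace_eq_one] at h
  exact sub_nonneg.mp h

theorem State.trace_mono (ρ : State) (G : QSigmaSet) :
    Monotone fun n => (Matrix.trace (ρ.mat n * G.proj n)).re := by
  refine monotone_nat_of_le_succ fun n => ?_
  have hq := G.special (n + 1)
  have hp := G.special n
  have hP := tensorId_isHermitian hp.isHermitian
  have h1 := mul_eq_of_range_le hq.isIdempotent (G.nested n)
  have h2 : tensorId (G.proj n) * G.proj (n + 1) = tensorId (G.proj n) := by
    have := congrArg Matrix.conjTranspose h1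
    rwa [Matrix.conjTranspose_mul, hP.eq, hq.isHermitian.eq] at this
  have h := trace_mul_nonneg (ρ.density (n + 1)).posSemidef (hq.isHermitian.sub hP) (by
    rw [Matrix.mul_sub, Matrix.sub_mul, Matrix.sub_mul, h1, h2, hq.isIdempotent, tensorId_mul,
      hp.isIdempotent]; simp)
  rw [Matrix.mul_sub, Matrix.trace_sub, trace_mul_tensorId, ρ.coherent] at h
  exact (Complex.le_def.mp (sub_nonneg.mp h)).1

/-- The limit in the definition of `ρ(G)` exists. -/
theorem State.tendsto_value (ρ : State) (G : QSigmaSet) :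
    Tendsto (fun n => Matrix.trace (ρ.mat n * G.proj n)) atTop (𝓝 (ρ.value G : ℂ)) := by
  have h : Tendsto (fun n => (Matrix.trace (ρ.mat n * G.proj n)).re) atTop (𝓝 (ρ.value G)) := by
    refine tendsto_nhds_limUnder ⟨_, tendsto_atTop_ciSup (ρ.trace_mono G) ⟨1, ?_⟩⟩
    rintro _ ⟨n, rfl⟩
    exact (Complex.le_def.mp (ρ.trace_mem G n).2).1
  have h2 := (Complex.continuous_ofReal.tendsto _).comp h
  refine h2.congr fun n => ?_
  refine Complex.ext (Complex.ofReal_re _) ?_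
  exact (Complex.le_def.mp (ρ.trace_mem G n).1).2

theorem State.value_mem_Icc (ρ : State) (G : QSigmaSet) : ρ.value G ∈ Set.Icc (0 : ℝ) 1 := by
  have h := (Complex.continuous_re.tendsto _).comp (ρ.tendsto_value G)
  exact ⟨ge_of_tendsto' h fun n => (Complex.le_def.mp (ρ.trace_mem G n).1).1,
    le_of_tendsto' h fun n => (Complex.le_def.mp (ρ.trace_mem G n).2).1⟩

end QRand

end

noncomputable section

namespace QRand

/-! ### Computable arithmetic on integers and Gaussian integers -/

/-! One direction is soft: by the geometric series a Martin-Löf test is a Solovay test, and if the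
infimum of the values is positive, half of it is a level at which the state fails.

For the converse let `S` be a Solovay test with `∑ τ(S k) ≤ C`, and let `H_t` be the sum of the
projections of the first `t + 1` sets at stage `t` (`partialSum`). Classically one would take the
points that lie in many of the sets. The quantum analogue is a projection `T_t` off which `H_t` is
at most `lam`. Spectral projections of `H_t` will not do: `H_t ⊗ I ≤ H_{t+1}` does not make their
ranges nested. Instead `T_t` is grown greedily from `T_{t-1} ⊗ I`, by one dimension at a time, along
directions orthogonal to it on which the quadratic form of `H_t` exceeds `lam`
(`IsGaussianProj.exists_extend`, `IsGaussianProj.exists_maximal`). The invariant `lam * tr T_t < tr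
(T_t H_t) + 2 ^ t` survives both the growth and the passage to the next stage, and with `lam = (C +
1) * 2 ^ m` it gives `τ(T) ≤ 2⁻ᵐ`.

When no direction is left, `H_t ≤ (lam + 1) + c T_t` for some `c` (`posSemidef_domination`). Let `ρ`
exceed `δ` on infinitely many sets. Take `M` of them, with sum `H' ≤ H_t` at a late stage; then `M δ
≤ tr (ρ H')`. Pinching by `T_t` bounds `tr (ρ H')` by `2 M tr (ρ T_t)` plus a constant that does not
depend on `M` (`trace_re_le_of_domination`). For large `M` this forces `tr (ρ T_t) ≥ δ / 4`, for
every `m`, so `ρ` is not Martin-Löf random.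

The rest is effectivity. The entries of `H_t` are known only through codes of algebraic numbers, so
`T_t` is found by unbounded search among projections with Gaussian rational entries. What is
searched for is a certificate that is decidable from approximations (`ProjCert.Valid`): it implies
the invariant and the domination up to a small entrywise error, and the greedy construction shows
that one exists. The approximations come from another search (`AlgCode.Cert`), in which Lipschitz
bounds on a grid exclude roots far from the proposed value. -/

theorem encode_int_natCast (n : ℕ) : Encodable.encode (n : ℤ) = 2 * n := rfl

theorem encode_int_negSucc (n : ℕ) : Encodable.encode (Int.negSucc n) = 2 * n + 1 := rfl

theorem primrec_int_toNat : Primrec Int.toNat := by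
  have h : Primrec fun z : ℤ =>
      bif (Encodable.encode z).bodd then 0 else (Encodable.encode z).div2 :=
    Primrec.cond (Primrec.nat_bodd.comp Primrec.encode) (Primrec.const 0)
      (Primrec.nat_div2.comp Primrec.encode)
  refine h.of_eq fun z => ?_
  rcases z with n | n
  · rw [Int.ofNat_eq_natCast, encode_int_natCast]; simp
  · rw [encode_int_negSucc]; simp

theorem primrec_int_neg_toNat : Primrec fun z : ℤ => (-z).toNat := by
  have h : Primrec fun z : ℤ =>
      bif (Encodable.encode z).bodd then (Encodable.encode z).div2 + 1 else 0 :=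
    Primrec.cond (Primrec.nat_bodd.comp Primrec.encode)
      (Primrec.succ.comp (Primrec.nat_div2.comp Primrec.encode)) (Primrec.const 0)
  refine h.of_eq fun z => ?_
  rcases z with n | n
  · rw [Int.ofNat_eq_natCast, encode_int_natCast]; simp
  · rw [encode_int_negSucc]; simp [Int.neg_negSucc]

/-- Integer arithmetic is reduced to this map: each integer is the difference of its positive and
negative parts, so sums and products become differences of natural number expressions. -/
theorem primrec_natCast_sub : Primrec₂ fun p q : ℕ => (p : ℤ) - q := by
  have h : Primrec₂ fun p q : ℕ =>
      if q ≤ p then 2 * (p - q) else 2 * (q - p - 1) + 1 := by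
    refine Primrec.ite (Primrec.nat_le.comp Primrec.snd Primrec.fst) ?_ ?_
    · exact Primrec.nat_mul.comp (Primrec.const 2)
        (Primrec.nat_sub.comp Primrec.fst Primrec.snd)
    · exact Primrec.succ.comp (Primrec.nat_mul.comp (Primrec.const 2)
        (Primrec.nat_sub.comp (Primrec.nat_sub.comp Primrec.snd Primrec.fst) (Primrec.const 1)))
  refine Primrec₂.encode_iff.1 (h.of_eq fun p q => ?_)
  split_ifs with hqp
  · rw [← Nat.cast_sub hqp, encode_int_natCast]
  · have : (p : ℤ) - q = Int.negSucc (q - p - 1) := by omega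
    rw [this, encode_int_negSucc]

theorem primrec_int_add : Primrec₂ fun x y : ℤ => x + y := by
  have h : Primrec₂ fun x y : ℤ =>
      ((x.toNat + y.toNat : ℕ) : ℤ) - ((-x).toNat + (-y).toNat : ℕ) :=
    primrec_natCast_sub.comp
      (Primrec.nat_add.comp (primrec_int_toNat.comp Primrec.fst)
        (primrec_int_toNat.comp Primrec.snd))
      (Primrec.nat_add.comp (primrec_int_neg_toNat.comp Primrec.fst)
        (primrec_int_neg_toNat.comp Primrec.snd))
  exact h.of_eq fun x y => by omega

theorem primrec_int_neg : Primrec fun x : ℤ => -x := by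
  have h : Primrec fun x : ℤ => (((-x).toNat : ℕ) : ℤ) - (x.toNat : ℕ) :=
    primrec_natCast_sub.comp primrec_int_neg_toNat primrec_int_toNat
  exact h.of_eq fun x => by omega

theorem primrec_int_mul : Primrec₂ fun x y : ℤ => x * y := by
  have h : Primrec₂ fun x y : ℤ =>
      ((x.toNat * y.toNat + (-x).toNat * (-y).toNat : ℕ) : ℤ) -
        (x.toNat * (-y).toNat + (-x).toNat * y.toNat : ℕ) := by
    have h1 := primrec_int_toNat.comp (Primrec.fst (α := ℤ) (β := ℤ))
    have h2 := primrec_int_toNat.comp (Primrec.snd (α := ℤ) (β := ℤ))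
    have h3 := primrec_int_neg_toNat.comp (Primrec.fst (α := ℤ) (β := ℤ))
    have h4 := primrec_int_neg_toNat.comp (Primrec.snd (α := ℤ) (β := ℤ))
    exact primrec_natCast_sub.comp
      (Primrec.nat_add.comp (Primrec.nat_mul.comp h1 h2) (Primrec.nat_mul.comp h3 h4))
      (Primrec.nat_add.comp (Primrec.nat_mul.comp h1 h4) (Primrec.nat_mul.comp h3 h2))
  refine h.of_eq fun x y => ?_
  have hx : x = (x.toNat : ℤ) - ((-x).toNat : ℤ) := by omega
  have hy : y = (y.toNat : ℤ) - ((-y).toNat : ℤ) := by omega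
  conv_rhs => rw [hx, hy]
  push_cast
  ring

/-- Gaussian integers as pairs of integers. -/
def gaussianEquiv : GaussianInt ≃ ℤ × ℤ where
  toFun z := (z.re, z.im)
  invFun p := ⟨p.1, p.2⟩
  left_inv _ := rfl
  right_inv _ := rfl

instance : Primcodable GaussianInt := Primcodable.ofEquiv _ gaussianEquiv

theorem primrec_gaussian_re : Primrec fun z : GaussianInt => z.re :=
  Primrec.fst.comp (Primrec.of_equiv (e := gaussianEquiv))

theorem primrec_gaussian_im : Primrec fun z : GaussianInt => z.im :=
  Primrec.snd.comp (Primrec.of_equiv (e := gaussianEquiv))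

theorem primrec_gaussian_mk : Primrec₂ fun x y : ℤ => (⟨x, y⟩ : GaussianInt) :=
  Primrec.of_equiv_symm (e := gaussianEquiv)

/-! ### Closure of computable functions under arithmetic and finite sums -/

section closure

variable {α β : Type*} [Primcodable α] [Primcodable β]

theorem _root_.Computable.nat_add {f g : α → ℕ} (hf : Computable f) (hg : Computable g) :
    Computable fun a => f a + g a :=
  Primrec.nat_add.to_comp.comp hf hg

theorem _root_.Computable.nat_mul {f g : α → ℕ} (hf : Computable f) (hg : Computable g) :
    Computable fun a => f a * g a :=
  Primrec.nat_mul.to_comp.comp hf hg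

theorem _root_.Computable.nat_pow {f g : α → ℕ} (hf : Computable f) (hg : Computable g) :
    Computable fun a => f a ^ g a :=
  (Primrec₂.unpaired'.1 Nat.Primrec.pow).to_comp.comp hf hg

theorem _root_.Computable.nat_div {f g : α → ℕ} (hf : Computable f) (hg : Computable g) :
    Computable fun a => f a / g a :=
  Primrec.nat_div.to_comp.comp hf hg

theorem _root_.Computable.nat_mod {f g : α → ℕ} (hf : Computable f) (hg : Computable g) :
    Computable fun a => f a % g a :=
  Primrec.nat_mod.to_comp.comp hf hg

theorem _root_.Computable.natPair {f g : α → ℕ} (hf : Computable f) (hg : Computable g) :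
    Computable fun a => Nat.pair (f a) (g a) :=
  Primrec₂.natPair.to_comp.comp hf hg

theorem _root_.Computable.int_add {f g : α → ℤ} (hf : Computable f) (hg : Computable g) :
    Computable fun a => f a + g a :=
  primrec_int_add.to_comp.comp hf hg

theorem _root_.Computable.int_neg {f : α → ℤ} (hf : Computable f) :
    Computable fun a => -f a :=
  primrec_int_neg.to_comp.comp hf

theorem _root_.Computable.int_sub {f g : α → ℤ} (hf : Computable f) (hg : Computable g) :
    Computable fun a => f a - g a :=
  (hf.int_add hg.int_neg).of_eq fun _ => (sub_eq_add_neg _ _).symm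

theorem _root_.Computable.int_mul {f g : α → ℤ} (hf : Computable f) (hg : Computable g) :
    Computable fun a => f a * g a :=
  primrec_int_mul.to_comp.comp hf hg

theorem _root_.Computable.int_natCast {f : α → ℕ} (hf : Computable f) :
    Computable fun a => (f a : ℤ) :=
  ((primrec_natCast_sub.comp Primrec.id (Primrec.const 0)).to_comp.comp hf).of_eq
    fun _ => by simp

theorem _root_.Computable.int_natAbs {f : α → ℤ} (hf : Computable f) :
    Computable fun a => (f a).natAbs :=
  ((primrec_int_toNat.to_comp.comp hf).nat_add (primrec_int_neg_toNat.to_comp.comp hf)).of_eq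
    fun _ => by omega

theorem _root_.Computable.gaussian_re {f : α → GaussianInt} (hf : Computable f) :
    Computable fun a => (f a).re :=
  primrec_gaussian_re.to_comp.comp hf

theorem _root_.Computable.gaussian_im {f : α → GaussianInt} (hf : Computable f) :
    Computable fun a => (f a).im :=
  primrec_gaussian_im.to_comp.comp hf

theorem _root_.Computable.gaussian_mk {f g : α → ℤ} (hf : Computable f) (hg : Computable g) :
    Computable fun a => (⟨f a, g a⟩ : GaussianInt) :=
  primrec_gaussian_mk.to_comp.comp hf hg

theorem _root_.Computable.gaussian_add {f g : α → GaussianInt} (hf : Computable f)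
    (hg : Computable g) : Computable fun a => f a + g a :=
  ((hf.gaussian_re.int_add hg.gaussian_re).gaussian_mk
    (hf.gaussian_im.int_add hg.gaussian_im)).of_eq fun _ => rfl

theorem _root_.Computable.gaussian_sub {f g : α → GaussianInt} (hf : Computable f)
    (hg : Computable g) : Computable fun a => f a - g a :=
  ((hf.gaussian_re.int_sub hg.gaussian_re).gaussian_mk
    (hf.gaussian_im.int_sub hg.gaussian_im)).of_eq fun _ => by ext <;> simp

theorem _root_.Computable.gaussian_mul {f g : α → GaussianInt} (hf : Computable f)
    (hg : Computable g) : Computable fun a => f a * g a :=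
  (((hf.gaussian_re.int_mul hg.gaussian_re).int_sub
      (hf.gaussian_im.int_mul hg.gaussian_im)).gaussian_mk
    ((hf.gaussian_re.int_mul hg.gaussian_im).int_add
      (hf.gaussian_im.int_mul hg.gaussian_re))).of_eq fun _ => by ext <;> simp; ring

theorem _root_.Computable.gaussian_star {f : α → GaussianInt} (hf : Computable f) :
    Computable fun a => star (f a) :=
  (hf.gaussian_re.gaussian_mk hf.gaussian_im.int_neg).of_eq fun _ => by ext <;> simp

theorem _root_.Computable.gaussian_intCast {f : α → ℤ} (hf : Computable f) :
    Computable fun a => ((f a : ℤ) : GaussianInt) :=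
  (hf.gaussian_mk (Computable.const 0)).of_eq fun _ => by ext <;> simp

theorem _root_.Computable.gaussian_natCast {f : α → ℕ} (hf : Computable f) :
    Computable fun a => ((f a : ℕ) : GaussianInt) :=
  hf.int_natCast.gaussian_intCast.of_eq fun _ => by simp

theorem _root_.Computable.gaussian_norm_natAbs {f : α → GaussianInt} (hf : Computable f) :
    Computable fun a => (f a).norm.natAbs :=
  ((hf.gaussian_re.int_mul hf.gaussian_re).int_add
    (hf.gaussian_im.int_mul hf.gaussian_im)).int_natAbs.of_eq fun _ => by
      rw [Zsqrtd.norm_def]; ring_nf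

theorem _root_.Computable.gaussian_pow {f : α → GaussianInt} {g : α → ℕ} (hf : Computable f)
    (hg : Computable g) : Computable fun a => f a ^ g a := by
  have h : Computable fun a =>
      (Nat.rec 1 (fun _ y => y * f a) (g a) : GaussianInt) :=
    Computable.nat_rec hg (Computable.const 1)
      ((Computable.snd.comp Computable.snd).gaussian_mul (hf.comp Computable.fst)).to₂
  refine h.of_eq fun a => ?_
  induction g a with
  | zero => simp
  | succ n ih => simp only [ih, pow_succ]

theorem _root_.Computable.sum_range {M : Type*} [Primcodable M] [AddCommMonoid M]
    (hadd : Computable₂ fun x y : M => x + y) {n : α → ℕ} {f : α → ℕ → M}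
    (hn : Computable n) (hf : Computable fun p : α × ℕ => f p.1 p.2) :
    Computable fun a => ∑ i ∈ Finset.range (n a), f a i := by
  have h : Computable fun a => (Nat.rec 0 (fun i y => y + f a i) (n a) : M) :=
    Computable.nat_rec hn (Computable.const 0)
      (hadd.comp (Computable.snd.comp Computable.snd)
        (hf.comp (Computable.fst.pair (Computable.fst.comp Computable.snd)))).to₂
  refine h.of_eq fun a => ?_
  induction n a with
  | zero => simp
  | succ k ih => simp only [ih, Finset.sum_range_succ]

theorem _root_.Computable.nat_sum {n : α → ℕ} {f : α → ℕ → ℕ}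
    (hn : Computable n) (hf : Computable fun p : α × ℕ => f p.1 p.2) :
    Computable fun a => ∑ i ∈ Finset.range (n a), f a i :=
  Computable.sum_range Primrec.nat_add.to_comp hn hf

theorem _root_.Computable.gaussian_sum {n : α → ℕ} {f : α → ℕ → GaussianInt}
    (hn : Computable n) (hf : Computable fun p : α × ℕ => f p.1 p.2) :
    Computable fun a => ∑ i ∈ Finset.range (n a), f a i :=
  Computable.sum_range (Computable.fst.gaussian_add Computable.snd).to₂ hn hf

theorem _root_.Computable.ite {M : Type*} [Primcodable M] {p : α → Prop} [DecidablePred p]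
    {f g : α → M} (hp : ComputablePred p) (hf : Computable f) (hg : Computable g) :
    Computable fun a => if p a then f a else g a :=
  (Computable.cond hp.decide hf hg).of_eq fun a => by by_cases h : p a <;> simp [h]

theorem _root_.Computable.list_getD {M : Type*} [Primcodable M] (d : M) {l : α → List M}
    {n : α → ℕ} (hl : Computable l) (hn : Computable n) :
    Computable fun a => (l a).getD (n a) d :=
  (Primrec.list_getD d).to_comp.comp hl hn

/-! ### Computable predicates -/

theorem _root_.ComputablePred.and {p q : α → Prop} (hp : ComputablePred p)
    (hq : ComputablePred q) : ComputablePred fun a => p a ∧ q a := by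
  classical
  exact ((Primrec.and.to_comp.comp hp.decide hq.decide).of_eq
    fun a => by simp : Computable fun a => decide (p a ∧ q a)).computablePred

theorem _root_.ComputablePred.or {p q : α → Prop} (hp : ComputablePred p)
    (hq : ComputablePred q) : ComputablePred fun a => p a ∨ q a :=
  (hp.not.and hq.not).not.of_eq fun a => by tauto

theorem _root_.ComputablePred.imp {p q : α → Prop} (hp : ComputablePred p)
    (hq : ComputablePred q) : ComputablePred fun a => p a → q a :=
  (hp.not.or hq).of_eq fun a => by tauto

theorem _root_.ComputablePred.comp {p : β → Prop} {f : α → β} (hp : ComputablePred p)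
    (hf : Computable f) : ComputablePred fun a => p (f a) := by
  classical
  exact (hp.decide.comp hf).computablePred

theorem _root_.Computable.eq_pred {f g : α → β} (hf : Computable f) (hg : Computable g) :
    ComputablePred fun a => f a = g a :=
  (Primrec.eq (α := β)).computablePred.comp (hf.pair hg)

theorem _root_.Computable.nat_le_pred {f g : α → ℕ} (hf : Computable f) (hg : Computable g) :
    ComputablePred fun a => f a ≤ g a :=
  Primrec.nat_le.computablePred.comp (hf.pair hg)

theorem _root_.Computable.nat_lt_pred {f g : α → ℕ} (hf : Computable f) (hg : Computable g) :
    ComputablePred fun a => f a < g a :=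
  Primrec.nat_lt.computablePred.comp (hf.pair hg)

theorem _root_.Computable.int_lt_pred {f g : α → ℤ} (hf : Computable f) (hg : Computable g) :
    ComputablePred fun a => f a < g a :=
  ((Computable.const 0).nat_lt_pred (primrec_int_toNat.to_comp.comp (hg.int_sub hf))).of_eq
    fun a => by omega

/-- The bounded quantifier holds exactly when the number of counterexamples, a computable sum, is
zero. -/
theorem _root_.ComputablePred.forall_lt {n : α → ℕ} {p : α → ℕ → Prop} (hn : Computable n)
    (hp : ComputablePred fun q : α × ℕ => p q.1 q.2) :
    ComputablePred fun a => ∀ i < n a, p a i := by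
  classical
  have h : Computable fun a => ∑ i ∈ Finset.range (n a), if p a i then 0 else 1 :=
    Computable.nat_sum hn (Computable.ite hp (Computable.const 0) (Computable.const 1))
  exact (h.eq_pred (Computable.const 0)).of_eq fun a => by simp

/-- Unbounded search: a computable relation that is total has a computable choice function. -/
theorem exists_computable_choice [Inhabited β] {R : α → β → Prop}
    (hR : ComputablePred fun p : α × β => R p.1 p.2) (h : ∀ a, ∃ b, R a b) :
    ∃ f : α → β, Computable f ∧ ∀ a, R a (f a) := by
  classical
  -- Numbers that encode nothing are read as `default`, so `dec` is total and still surjective.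
  let dec : ℕ → β := fun n => (Encodable.decode n).getD default
  have hdec : Computable dec :=
    Computable.option_getD Computable.decode (Computable.const default)
  have hex : ∀ a, ∃ n, R a (dec n) := fun a => by
    obtain ⟨b, hb⟩ := h a
    exact ⟨Encodable.encode b, by simpa [dec] using hb⟩
  have hfind := Computable.find (P := fun a n => R a (dec n))
    (hR.comp (Computable.fst.pair (hdec.comp Computable.snd))) hex
  exact ⟨_, hdec.comp hfind, fun a => Nat.find_spec (hex a)⟩

end closure

/-! ### Approximating the number that a code represents -/

/-- Squared norms of Gaussian integers are natural numbers, so comparisons of norms can be decided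
after squaring. -/
theorem norm_natAbs_eq (x : GaussianInt) :
    (x.norm.natAbs : ℝ) = ‖GaussianInt.toComplex x‖ ^ 2 := by
  rw [← Complex.normSq_eq_norm_sq, ← GaussianInt.intCast_real_norm, Nat.cast_natAbs,
    abs_of_nonneg (GaussianInt.norm_nonneg x)]

theorem toComplex_norm_sq (x : GaussianInt) :
    ‖GaussianInt.toComplex x‖ ^ 2 = (x.re : ℝ) ^ 2 + (x.im : ℝ) ^ 2 := by
  rw [← Complex.normSq_eq_norm_sq, Complex.normSq_apply, GaussianInt.re_toComplex,
    GaussianInt.im_toComplex]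
  ring

/-- Rounding is towards zero, so that absolute values do not grow. This later keeps a rounded offset
inside the disc of a code. -/
theorem exists_int_trunc (x : ℝ) : ∃ k : ℤ, |(k : ℝ)| ≤ |x| ∧ |x - k| ≤ 1 := by
  rcases le_total 0 x with h | h
  · refine ⟨⌊x⌋, ?_, ?_⟩
    · rw [abs_of_nonneg h, abs_of_nonneg (by exact_mod_cast Int.floor_nonneg.2 h)]
      exact Int.floor_le x
    · rw [abs_le]
      constructor <;> linarith [Int.floor_le x, Int.lt_floor_add_one x]
  · refine ⟨⌈x⌉, ?_, ?_⟩
    · have h' : ((⌈x⌉ : ℤ) : ℝ) ≤ 0 := by exact_mod_cast Int.ceil_le.2 (by simpa using h)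
      rw [abs_of_nonpos h, abs_of_nonpos h']
      linarith [Int.le_ceil x]
    · rw [abs_le]
      constructor <;> linarith [Int.le_ceil x, Int.ceil_lt_add_one x]

/-- Every complex number is near a Gaussian integer of at most its size. -/
theorem exists_gaussian_trunc (z : ℂ) : ∃ q : GaussianInt,
    ‖GaussianInt.toComplex q‖ ≤ ‖z‖ ∧ ‖z - GaussianInt.toComplex q‖ < 2 := by
  obtain ⟨k, hk, hk'⟩ := exists_int_trunc z.re
  obtain ⟨l, hl, hl'⟩ := exists_int_trunc z.im
  refine ⟨⟨k, l⟩, ?_, ?_⟩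
  · refine le_of_sq_le_sq ?_ (norm_nonneg _)
    rw [toComplex_norm_sq, ← Complex.normSq_eq_norm_sq, Complex.normSq_apply]
    have h1 := sq_le_sq.2 hk
    have h2 := sq_le_sq.2 hl
    simp only
    linarith
  · refine lt_of_pow_lt_pow_left₀ 2 (by norm_num) ?_
    rw [← Complex.normSq_eq_norm_sq, Complex.normSq_apply, Complex.sub_re, Complex.sub_im,
      GaussianInt.re_toComplex, GaussianInt.im_toComplex]
    have h1 := sq_le_one_iff_abs_le_one _ |>.2 hk'
    have h2 := sq_le_one_iff_abs_le_one _ |>.2 hl'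
    nlinarith

theorem aeval_polyOfList (z : ℂ) (l : List ℤ) :
    Polynomial.aeval z (polyOfList l) =
      ∑ j ∈ Finset.range l.length, (l.getD j 0 : ℂ) * z ^ j := by
  induction l with
  | nil => simp [polyOfList]
  | cons a l ih =>
    simp only [polyOfList, map_add, map_mul, Polynomial.aeval_X, ih, List.length_cons,
      Finset.sum_range_succ', List.getD_cons_succ, List.getD_cons_zero, pow_succ, pow_zero,
      mul_one, Finset.mul_sum]
    rw [add_comm]
    congr 1
    · exact Finset.sum_congr rfl fun _ _ => by ring
    · simp

/-- A Lipschitz constant, on the disc of radius `R` around the origin, of the polynomial with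
coefficients `l`. -/
def lipConst (l : List ℤ) (R : ℕ) : ℕ :=
  ∑ j ∈ Finset.range l.length, (l.getD j 0).natAbs * (R + 1) ^ j

/-- The crude factor `(R + 1) ^ j` makes the induction close, since `R * (R + 1) ^ j + (R + 1) ^ j =
(R + 1) ^ (j + 1)`. -/
theorem norm_pow_sub_pow_le {w g : ℂ} {R : ℝ} (hw : ‖w‖ ≤ R) (hg : ‖g‖ ≤ R) (j : ℕ) :
    ‖w ^ j - g ^ j‖ ≤ ‖w - g‖ * (R + 1) ^ j := by
  have hR : 0 ≤ R := (norm_nonneg w).trans hw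
  induction j with
  | zero => simp
  | succ j ih =>
    have h : w ^ (j + 1) - g ^ (j + 1) = w * (w ^ j - g ^ j) + (w - g) * g ^ j := by ring
    rw [h]
    refine (norm_add_le _ _).trans ?_
    rw [norm_mul, norm_mul, norm_pow]
    have h1 : ‖w‖ * ‖w ^ j - g ^ j‖ ≤ R * (‖w - g‖ * (R + 1) ^ j) := by gcongr
    have h2 : ‖w - g‖ * ‖g‖ ^ j ≤ ‖w - g‖ * (R + 1) ^ j := by gcongr; linarith
    calc _ ≤ _ := add_le_add h1 h2
      _ = _ := by ring

theorem norm_aeval_sub_le {w g : ℂ} {R : ℕ} (hw : ‖w‖ ≤ R) (hg : ‖g‖ ≤ R) (l : List ℤ) :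
    ‖Polynomial.aeval w (polyOfList l) - Polynomial.aeval g (polyOfList l)‖ ≤
      ‖w - g‖ * lipConst l R := by
  rw [aeval_polyOfList, aeval_polyOfList, ← Finset.sum_sub_distrib, lipConst, Nat.cast_sum,
    Finset.mul_sum]
  refine norm_sum_le_of_le _ fun j _ => ?_
  rw [← mul_sub, norm_mul, Complex.norm_intCast]
  push_cast
  rw [Nat.cast_natAbs, Int.cast_abs]
  calc _ ≤ |((l.getD j 0 : ℤ) : ℝ)| * (‖w - g‖ * (R + 1) ^ j) := by
        gcongr; exact norm_pow_sub_pow_le hw hg j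
    _ = _ := by ring

/-- The value at `u / s` of the polynomial with coefficients `l`, multiplied by a power of `s`. -/
def homEval (l : List ℤ) (u : GaussianInt) (s : ℕ) : GaussianInt :=
  ∑ j ∈ Finset.range l.length,
    ((l.getD j 0 : ℤ) : GaussianInt) * u ^ j * (s : GaussianInt) ^ (l.length - j)

theorem toComplex_homEval (l : List ℤ) (u : GaussianInt) {s : ℕ} (hs : 0 < s) :
    GaussianInt.toComplex (homEval l u s) = (s : ℂ) ^ l.length *
      Polynomial.aeval (GaussianInt.toComplex u / s) (polyOfList l) := by
  have hs' : (s : ℂ) ≠ 0 := by exact_mod_cast hs.ne'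
  rw [aeval_polyOfList, homEval, map_sum, Finset.mul_sum]
  refine Finset.sum_congr rfl fun j hj => ?_
  have hj' := (Finset.mem_range.1 hj).le
  simp only [map_mul, map_pow, map_intCast, map_natCast, div_pow]
  rw [← Nat.sub_add_cancel hj', pow_add, Nat.add_sub_cancel]
  field_simp

/-- The point of a grid of mesh `1 / ((k + 1) * r)`, scaled to be a Gaussian integer, at offset
`o` from the centre of the disc of `c`. -/
def gridPoint (c : AlgCode) (r : ℕ) (o : GaussianInt) : GaussianInt :=
  ⟨c.2.1.1, c.2.1.2⟩ * (r : GaussianInt) + o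

/-- A bound for the absolute value of the points of the disc of `c`. -/
def AlgCode.radius (c : AlgCode) : ℕ := c.2.1.1.natAbs + c.2.1.2.natAbs + 1

/-- A decidable certificate for `q / d` being near the number that `c` represents: at the grid
points of the disc of `c` that are not near `q / d`, the polynomial of `c` is so large that it has
no root nearby. -/
def AlgCode.Cert (c : AlgCode) (d : ℕ) (q : GaussianInt) (n : ℕ) : Prop :=
  ∀ x < 2 * (d * (n + 1)) + 1, ∀ y < 2 * (d * (n + 1)) + 1,
    (⟨(x : ℤ) - (d * (n + 1) : ℕ), (y : ℤ) - (d * (n + 1) : ℕ)⟩ : GaussianInt).norm.natAbs ≤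
      (d * (n + 1)) ^ 2 →
    ((d : GaussianInt) * gridPoint c (d * (n + 1))
        ⟨(x : ℤ) - (d * (n + 1) : ℕ), (y : ℤ) - (d * (n + 1) : ℕ)⟩ -
        (((c.2.2 + 1) * (d * (n + 1)) : ℕ) : GaussianInt) * q).norm.natAbs ≤
      4 * ((c.2.2 + 1) * (d * (n + 1))) ^ 2 ∨
    4 * lipConst c.1 c.radius ^ 2 * ((c.2.2 + 1) * (d * (n + 1))) ^ (2 * c.1.length) <
      (homEval c.1 (gridPoint c (d * (n + 1))
        ⟨(x : ℤ) - (d * (n + 1) : ℕ), (y : ℤ) - (d * (n + 1) : ℕ)⟩)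
        ((c.2.2 + 1) * (d * (n + 1)))).norm.natAbs * ((c.2.2 + 1) * (d * (n + 1))) ^ 2

/-- The property of certificates in terms of complex numbers. -/
theorem AlgCode.cert_iff {c : AlgCode} {d : ℕ} (hd : 0 < d) {q : GaussianInt} {n r s : ℕ}
    (hr : r = d * (n + 1)) (hs : s = (c.2.2 + 1) * r) :
    c.Cert d q n ↔ ∀ o : GaussianInt, ‖GaussianInt.toComplex o‖ ≤ r →
      ‖(d : ℂ) * GaussianInt.toComplex (gridPoint c r o) - s * GaussianInt.toComplex q‖ ≤ 2 * s ∨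
      2 * lipConst c.1 c.radius < ‖Polynomial.aeval
        (GaussianInt.toComplex (gridPoint c r o) / s) (polyOfList c.1)‖ * s := by
  have hr0 : 0 < r := by rw [hr]; positivity
  have hs0 : 0 < s := by rw [hs]; positivity
  -- The integer tests in `Cert` are the squares of the inequalities with norms; the factor `s ^ (2
  -- * length)` in the second cancels the power of `s` that `homEval` carries.
  have key : ∀ o : GaussianInt,
      (((d : GaussianInt) * gridPoint c r o - (s : GaussianInt) * q).norm.natAbs ≤ 4 * s ^ 2 ↔
        ‖(d : ℂ) * GaussianInt.toComplex (gridPoint c r o) - s * GaussianInt.toComplex q‖ ≤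
          2 * s) ∧
      (4 * lipConst c.1 c.radius ^ 2 * s ^ (2 * c.1.length) <
          (homEval c.1 (gridPoint c r o) s).norm.natAbs * s ^ 2 ↔
        2 * lipConst c.1 c.radius < ‖Polynomial.aeval
          (GaussianInt.toComplex (gridPoint c r o) / s) (polyOfList c.1)‖ * s) := by
    intro o
    constructor
    · rw [← Nat.cast_le (α := ℝ), norm_natAbs_eq]
      push_cast
      rw [show (4 : ℝ) * s ^ 2 = (2 * s) ^ 2 by ring, sq_le_sq₀ (norm_nonneg _) (by positivity)]
      simp
    · rw [← Nat.cast_lt (α := ℝ), Nat.cast_mul, Nat.cast_mul _ (s ^ 2), norm_natAbs_eq,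
        toComplex_homEval _ _ hs0, norm_mul, norm_pow, Complex.norm_natCast]
      push_cast
      rw [← sq_lt_sq₀ (a := 2 * (lipConst c.1 c.radius : ℝ)) (by positivity) (by positivity)]
      have hpos : (0 : ℝ) < s ^ (2 * c.1.length) := by positivity
      rw [← mul_lt_mul_iff_of_pos_left hpos (b := (2 * (lipConst c.1 c.radius : ℝ)) ^ 2),
        iff_iff_eq]
      congr 1 <;> ring
  have hnorm : ∀ o : GaussianInt, o.norm.natAbs ≤ r ^ 2 ↔ ‖GaussianInt.toComplex o‖ ≤ r := by
    intro o
    rw [← Nat.cast_le (α := ℝ), norm_natAbs_eq, Nat.cast_pow,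
      sq_le_sq₀ (norm_nonneg _) (by positivity)]
  unfold AlgCode.Cert
  rw [← hr, ← hs]
  simp only [fun o => (key o).1, fun o => (key o).2, hnorm]
  constructor
  · intro h o ho
    have hre : |(o.re : ℝ)| ≤ r := by
      have := (Complex.abs_re_le_norm (GaussianInt.toComplex o)).trans ho
      rwa [GaussianInt.re_toComplex] at this
    have him : |(o.im : ℝ)| ≤ r := by
      have := (Complex.abs_im_le_norm (GaussianInt.toComplex o)).trans ho
      rwa [GaussianInt.im_toComplex] at this
    have hre' : |o.re| ≤ r := by exact_mod_cast hre
    have him' : |o.im| ≤ r := by exact_mod_cast him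
    rw [abs_le] at hre' him'
    -- The coordinates of an offset lie in `[-r, r]`; shifted by `r` they are the natural numbers
    -- below `2 * r + 1` over which `Cert` ranges.
    have ho' : (⟨((o.re + r).toNat : ℤ) - r, ((o.im + r).toNat : ℤ) - r⟩ : GaussianInt) = o := by
      ext <;> simp only <;> omega
    have := h (o.re + r).toNat (by omega) (o.im + r).toNat (by omega)
    rw [ho'] at this
    exact this ho
  · exact fun h x _ y _ hxy => h _ hxy

theorem AlgCode.toComplex_gridPoint_div (c : AlgCode) {r : ℕ} (hr : 0 < r) (o : GaussianInt) :
    GaussianInt.toComplex (gridPoint c r o) / (((c.2.2 + 1) * r : ℕ) : ℂ) =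
      ((c.2.1.1 : ℂ) + (c.2.1.2 : ℂ) * Complex.I) / ((c.2.2 : ℂ) + 1) +
        GaussianInt.toComplex o / (((c.2.2 + 1) * r : ℕ) : ℂ) := by
  have hr' : (r : ℂ) ≠ 0 := by exact_mod_cast hr.ne'
  have hk : (c.2.2 : ℂ) + 1 ≠ 0 := by exact_mod_cast Nat.succ_ne_zero c.2.2
  rw [gridPoint, map_add, map_mul, map_natCast, GaussianInt.toComplex_def']
  push_cast
  field_simp

theorem AlgCode.norm_le_radius {c : AlgCode} {w : ℂ} (hw : w ∈ c.disc) : ‖w‖ ≤ c.radius := by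
  have hk : (1 : ℝ) ≤ (c.2.2 : ℝ) + 1 := by simp
  have h1 : ‖(c.2.1.1 : ℂ) + (c.2.1.2 : ℂ) * Complex.I‖ ≤
      c.2.1.1.natAbs + c.2.1.2.natAbs := by
    refine (norm_add_le _ _).trans ?_
    rw [norm_mul, Complex.norm_I, Complex.norm_intCast, Complex.norm_intCast, Nat.cast_natAbs,
      Nat.cast_natAbs]
    simp
  have h2 : ‖((c.2.1.1 : ℂ) + (c.2.1.2 : ℂ) * Complex.I) / ((c.2.2 : ℂ) + 1)‖ ≤
      c.2.1.1.natAbs + c.2.1.2.natAbs := by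
    rw [norm_div, show ((c.2.2 : ℂ) + 1) = ((c.2.2 + 1 : ℕ) : ℂ) by push_cast; rfl,
      Complex.norm_natCast]
    push_cast
    exact (div_le_self (norm_nonneg _) hk).trans h1
  have h3 : 1 / ((c.2.2 : ℝ) + 1) ≤ 1 := by
    rw [div_le_one (by linarith)]; exact hk
  have h4 := mem_closedBall_iff_norm.1 hw
  have h5 := norm_sub_norm_le w
    (((c.2.1.1 : ℂ) + (c.2.1.2 : ℂ) * Complex.I) / ((c.2.2 : ℂ) + 1))
  unfold AlgCode.radius
  push_cast
  linarith

theorem AlgCode.gridPoint_mem_disc {c : AlgCode} {r : ℕ} (hr : 0 < r) {o : GaussianInt}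
    (ho : ‖GaussianInt.toComplex o‖ ≤ r) :
    GaussianInt.toComplex (gridPoint c r o) / (((c.2.2 + 1) * r : ℕ) : ℂ) ∈ c.disc := by
  have hr' : (0 : ℝ) < r := by exact_mod_cast hr
  rw [c.toComplex_gridPoint_div hr, AlgCode.disc, mem_closedBall_iff_norm, add_sub_cancel_left,
    norm_div, Complex.norm_natCast]
  push_cast
  rw [div_le_div_iff₀ (by positivity) (by positivity)]
  nlinarith [(by positivity : (0 : ℝ) ≤ (c.2.2 : ℝ) + 1)]

/-- Some grid point `g` of the disc satisfies `s ‖z - g‖ < 2`. As `z` is a root, the Lipschitz bound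
makes the polynomial at `g` too small for the second alternative of the certificate. Hence the first
one holds at `g` and gives `‖d g - q‖ ≤ 2`; since `d ≤ s`, moving from `g` to `z` costs at most
another `2`. -/
theorem AlgCode.Cert.norm_le {c : AlgCode} {z : ℂ} (hz : c.Represents z) {d : ℕ} (hd : 0 < d)
    {q : GaussianInt} {n : ℕ} (h : c.Cert d q n) :
    ‖(d : ℂ) * z - GaussianInt.toComplex q‖ ≤ 4 := by
  obtain ⟨-, hz0, hzd, -⟩ := hz
  obtain ⟨r, hr⟩ : ∃ r, r = d * (n + 1) := ⟨_, rfl⟩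
  obtain ⟨s, hs⟩ : ∃ s, s = (c.2.2 + 1) * r := ⟨_, rfl⟩
  have hr0 : 0 < r := by rw [hr]; positivity
  have hs0 : 0 < s := by rw [hs]; positivity
  have hs0' : (0 : ℝ) < s := by exact_mod_cast hs0
  have hsC : (s : ℂ) ≠ 0 := by exact_mod_cast hs0.ne'
  have hds : (d : ℝ) ≤ s := by
    have : d ≤ s := by
      rw [hs, hr]
      nlinarith [Nat.zero_le (c.2.2 * (d * (n + 1))), Nat.zero_le (d * n)]
    exact_mod_cast this
  rw [AlgCode.cert_iff hd hr hs] at h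
  set ζ : ℂ := ((c.2.1.1 : ℂ) + (c.2.1.2 : ℂ) * Complex.I) / ((c.2.2 : ℂ) + 1) with hζ
  obtain ⟨o, ho, ho'⟩ := exists_gaussian_trunc ((s : ℂ) * (z - ζ))
  have hor : ‖GaussianInt.toComplex o‖ ≤ r := by
    refine ho.trans ?_
    have := mem_closedBall_iff_norm.1 hzd
    rw [norm_mul, Complex.norm_natCast]
    calc (s : ℝ) * ‖z - ζ‖ ≤ s * (1 / ((c.2.2 : ℝ) + 1)) := by gcongr
      _ = r := by rw [hs]; push_cast; field_simp
  have hg := c.toComplex_gridPoint_div hr0 o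
  rw [← hs, ← hζ] at hg
  set g : ℂ := GaussianInt.toComplex (gridPoint c r o) / s with hgdef
  have hgu : GaussianInt.toComplex (gridPoint c r o) = s * g := by rw [hgdef]; field_simp
  have hzg : ‖(s : ℂ) * (z - g)‖ < 2 := by
    have : (s : ℂ) * (z - g) = s * (z - ζ) - GaussianInt.toComplex o := by
      rw [hg]; field_simp; ring
    rwa [this]
  have hgd : g ∈ c.disc := by rw [hgdef, hs]; exact AlgCode.gridPoint_mem_disc hr0 hor
  rcases h o hor with h1 | h1
  · rw [hgu] at h1
    have h2 : (s : ℂ) * (d * z - GaussianInt.toComplex q) =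
        d * (s * (z - g)) + (d * (s * g) - s * GaussianInt.toComplex q) := by ring
    have h3 : (s : ℝ) * ‖(d : ℂ) * z - GaussianInt.toComplex q‖ ≤ s * 4 := by
      have h4 := norm_add_le (d * ((s : ℂ) * (z - g))) (d * (s * g) - s * GaussianInt.toComplex q)
      rw [← h2, norm_mul, norm_mul (d : ℂ), Complex.norm_natCast, Complex.norm_natCast] at h4
      have h5 : (d : ℝ) * ‖(s : ℂ) * (z - g)‖ ≤ s * 2 := by gcongr
      linarith
    exact le_of_mul_le_mul_left h3 hs0'
  · exfalso
    have h2 := norm_aeval_sub_le (AlgCode.norm_le_radius hgd) (AlgCode.norm_le_radius hzd) c.1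
    rw [hz0, sub_zero, norm_sub_rev] at h2
    have h3 : ‖z - g‖ * s ≤ 2 := by
      rw [norm_mul, Complex.norm_natCast] at hzg
      linarith
    have h4 : (0 : ℝ) ≤ lipConst c.1 c.radius := by positivity
    nlinarith

/-- Take for `q` a rounding of `d z`. The points of the disc with `‖d w - q‖ ≥ 2` form a compact set
without roots, because `z` is the only root in the disc. So the polynomial is bounded below there by
some `η > 0`, and a fine enough grid satisfies the second alternative at all of them. -/
theorem AlgCode.exists_cert {c : AlgCode} {z : ℂ} (hz : c.Represents z) {d : ℕ} (hd : 0 < d) :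
    ∃ q n, c.Cert d q n := by
  obtain ⟨-, -, -, hz1⟩ := hz
  obtain ⟨q, -, hq⟩ := exists_gaussian_trunc ((d : ℂ) * z)
  have hK : IsCompact (c.disc ∩ {w | 2 ≤ ‖(d : ℂ) * w - GaussianInt.toComplex q‖}) :=
    (isCompact_closedBall _ _).inter_right
      (isClosed_le continuous_const (by fun_prop))
  obtain ⟨η, hη, hηK⟩ : ∃ η : ℝ, 0 < η ∧
      ∀ w ∈ c.disc ∩ {w | 2 ≤ ‖(d : ℂ) * w - GaussianInt.toComplex q‖},
        η ≤ ‖Polynomial.aeval w (polyOfList c.1)‖ := by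
    rcases (c.disc ∩ {w | 2 ≤ ‖(d : ℂ) * w - GaussianInt.toComplex q‖}).eq_empty_or_nonempty
      with he | hne
    · exact ⟨1, one_pos, by simp [he]⟩
    · obtain ⟨w, hw, hmin⟩ := hK.exists_isMinOn hne
        (f := fun w => ‖Polynomial.aeval w (polyOfList c.1)‖)
        (Polynomial.continuous_aeval _).norm.continuousOn
      refine ⟨_, norm_pos_iff.2 fun h0 => ?_, fun v hv => hmin hv⟩
      have hwz := hz1 w hw.1 h0
      rw [hwz] at hw
      exact absurd hw.2 (not_le.2 hq)
  obtain ⟨n, hn⟩ := exists_nat_gt (2 * (lipConst c.1 c.radius : ℝ) / η)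
  refine ⟨q, n, (AlgCode.cert_iff hd rfl rfl).2 fun o ho => ?_⟩
  obtain ⟨r, hr⟩ : ∃ r, r = d * (n + 1) := ⟨_, rfl⟩
  obtain ⟨s, hs⟩ : ∃ s, s = (c.2.2 + 1) * r := ⟨_, rfl⟩
  rw [← hr] at ho ⊢
  rw [← hs]
  have hr0 : 0 < r := by rw [hr]; positivity
  have hs0 : 0 < s := by rw [hs]; positivity
  have hsC : (s : ℂ) ≠ 0 := by exact_mod_cast hs0.ne'
  have hns : (n : ℝ) ≤ s := by
    have : n ≤ s := by
      rw [hs, hr]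
      nlinarith [Nat.zero_le (c.2.2 * (d * (n + 1)))]
    exact_mod_cast this
  have hgd := AlgCode.gridPoint_mem_disc (c := c) hr0 ho
  rw [← hs] at hgd
  set g : ℂ := GaussianInt.toComplex (gridPoint c r o) / s with hgdef
  have hgu : GaussianInt.toComplex (gridPoint c r o) = s * g := by rw [hgdef]; field_simp
  rcases lt_or_ge ‖(d : ℂ) * g - GaussianInt.toComplex q‖ 2 with h | h
  · left
    rw [hgu, show (d : ℂ) * (s * g) - s * GaussianInt.toComplex q =
      s * (d * g - GaussianInt.toComplex q) by ring, norm_mul, Complex.norm_natCast, mul_comm]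
    gcongr
  · right
    have h1 := hηK g ⟨hgd, h⟩
    rw [div_lt_iff₀ hη] at hn
    calc _ < n * η := hn
      _ ≤ s * ‖Polynomial.aeval g (polyOfList c.1)‖ := by gcongr
      _ = _ := mul_comm _ _

/-! ### Decidability of the root certificates -/

section

variable {α : Type*} [Primcodable α]

theorem computable_lipConst {l : α → List ℤ} {R : α → ℕ} (hl : Computable l)
    (hR : Computable R) : Computable fun a => lipConst (l a) (R a) := by
  refine Computable.nat_sum (Computable.list_length.comp hl) ?_
  exact (Computable.list_getD 0 (hl.comp Computable.fst) Computable.snd).int_natAbs.nat_mul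
    ((Computable.succ.comp (hR.comp Computable.fst)).nat_pow Computable.snd)

theorem computable_homEval {l : α → List ℤ} {u : α → GaussianInt} {s : α → ℕ}
    (hl : Computable l) (hu : Computable u) (hs : Computable s) :
    Computable fun a => homEval (l a) (u a) (s a) := by
  refine Computable.gaussian_sum (Computable.list_length.comp hl) ?_
  refine ((Computable.list_getD 0 (hl.comp Computable.fst)
    Computable.snd).gaussian_intCast.gaussian_mul
      ((hu.comp Computable.fst).gaussian_pow Computable.snd)).gaussian_mul
    ((hs.comp Computable.fst).gaussian_natCast.gaussian_pow ?_)
  exact Primrec.nat_sub.to_comp.comp (Computable.list_length.comp (hl.comp Computable.fst))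
    Computable.snd

theorem computable_gridPoint {c : α → AlgCode} {r : α → ℕ} {o : α → GaussianInt}
    (hc : Computable c) (hr : Computable r) (ho : Computable o) :
    Computable fun a => gridPoint (c a) (r a) (o a) := by
  have h1 := Computable.fst.comp (Computable.snd.comp hc)
  exact (((Computable.fst.comp h1).gaussian_mk (Computable.snd.comp h1)).gaussian_mul
    hr.gaussian_natCast).gaussian_add ho

theorem computable_radius {c : α → AlgCode} (hc : Computable c) :
    Computable fun a => (c a).radius := by
  have h1 := Computable.fst.comp (Computable.snd.comp hc)
  exact Computable.succ.comp ((Computable.fst.comp h1).int_natAbs.nat_add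
    (Computable.snd.comp h1).int_natAbs)

theorem computablePred_cert {c : α → AlgCode} {d : α → ℕ} {q : α → GaussianInt} {n : α → ℕ}
    (hc : Computable c) (hd : Computable d) (hq : Computable q) (hn : Computable n) :
    ComputablePred fun a => (c a).Cert (d a) (q a) (n a) := by
  have hr : Computable fun a => d a * (n a + 1) := hd.nat_mul (Computable.succ.comp hn)
  have hb : Computable fun a => 2 * (d a * (n a + 1)) + 1 :=
    Computable.succ.comp ((Computable.const 2).nat_mul hr)
  refine ComputablePred.forall_lt hb (ComputablePred.forall_lt (hb.comp Computable.fst) ?_)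
  have e : Computable fun p : (α × ℕ) × ℕ => p.1.1 := Computable.fst.comp Computable.fst
  have hc' := hc.comp e
  have hd' := hd.comp e
  have hq' := hq.comp e
  have hr' := hr.comp e
  have hs' := (Computable.succ.comp (Computable.snd.comp (Computable.snd.comp hc'))).nat_mul hr'
  have ho : Computable fun p : (α × ℕ) × ℕ =>
      (⟨(p.1.2 : ℤ) - (d p.1.1 * (n p.1.1 + 1) : ℕ),
        (p.2 : ℤ) - (d p.1.1 * (n p.1.1 + 1) : ℕ)⟩ : GaussianInt) :=
    ((Computable.snd.comp Computable.fst).int_natCast.int_sub hr'.int_natCast).gaussian_mk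
      (Computable.snd.int_natCast.int_sub hr'.int_natCast)
  have hu := computable_gridPoint hc' hr' ho
  have hl := Computable.fst.comp hc'
  refine (ho.gaussian_norm_natAbs.nat_le_pred (hr'.nat_pow (Computable.const 2))).imp
    (ComputablePred.or ?_ ?_)
  · exact ((hd'.gaussian_natCast.gaussian_mul hu).gaussian_sub
      (hs'.gaussian_natCast.gaussian_mul hq')).gaussian_norm_natAbs.nat_le_pred
      ((Computable.const 4).nat_mul (hs'.nat_pow (Computable.const 2)))
  · exact (((Computable.const 4).nat_mul ((computable_lipConst hl
      (computable_radius hc')).nat_pow (Computable.const 2))).nat_mul (hs'.nat_pow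
        ((Computable.const 2).nat_mul (Computable.list_length.comp hl)))).nat_lt_pred
      ((computable_homEval hl hu hs').gaussian_norm_natAbs.nat_mul
        (hs'.nat_pow (Computable.const 2)))

end

section LinearAlgebra

variable {n : Type*} [Fintype n] [DecidableEq n]

/-! ### Positive semidefinite matrices -/

open scoped MatrixOrder in
theorem _root_.Matrix.PosSemidef.exists_eq_conjTranspose_mul_self {P : Matrix n n ℂ}
    (hP : P.PosSemidef) : ∃ V : Matrix n n ℂ, P = Vᴴ * V := by
  obtain ⟨X, hX, -, h⟩ := sub_zero P ▸
    CFC.exists_sqrt_of_isSelfAdjoint_of_quasispectrumRestricts hP.isHermitian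
      (QuasispectrumRestricts.nnreal_of_nonneg hP.nonneg)
  exact ⟨X, by rw [← star_eq_conjTranspose, hX.star_eq, h, sub_zero]⟩

theorem _root_.Matrix.PosSemidef.trace_mul_nonneg {A B : Matrix n n ℂ} (hA : A.PosSemidef)
    (hB : B.PosSemidef) : 0 ≤ (trace (A * B)).re := by
  obtain ⟨V, rfl⟩ := hA.exists_eq_conjTranspose_mul_self
  have h := (hB.mul_mul_conjTranspose_same V).trace_nonneg
  rw [Matrix.trace_mul_comm, ← Matrix.mul_assoc] at h
  exact (Complex.le_def.1 h).1

theorem _root_.Matrix.PosSemidef.trace_mul_le {A B C : Matrix n n ℂ} (hA : A.PosSemidef)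
    (h : (C - B).PosSemidef) : (trace (A * B)).re ≤ (trace (A * C)).re := by
  have := hA.trace_mul_nonneg h
  rw [Matrix.mul_sub, trace_sub, Complex.sub_re] at this
  linarith

/-- With `A = Vᴴ V` this is `2 x y ≤ x ² + y ²` in each term. The arithmetic mean on the right is
linear in the diagonal, so summing over all entries yields a multiple of the trace. -/
theorem _root_.Matrix.PosSemidef.norm_apply_le {A : Matrix n n ℂ} (hA : A.PosSemidef) (i j : n) :
    ‖A i j‖ ≤ ((A i i).re + (A j j).re) / 2 := by
  obtain ⟨V, rfl⟩ := hA.exists_eq_conjTranspose_mul_self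
  have hdiag : ∀ i, ((Vᴴ * V) i i).re = ∑ k, ‖V k i‖ ^ 2 := fun i => by
    rw [Matrix.mul_apply, Complex.re_sum]
    refine Finset.sum_congr rfl fun k _ => ?_
    rw [conjTranspose_apply, Complex.star_def, ← Complex.normSq_eq_conj_mul_self,
      Complex.ofReal_re, Complex.normSq_eq_norm_sq]
  rw [hdiag, hdiag, Matrix.mul_apply, ← Finset.sum_add_distrib, Finset.sum_div]
  refine norm_sum_le_of_le _ fun k _ => ?_
  rw [norm_mul, conjTranspose_apply, norm_star]
  nlinarith [sq_nonneg (‖V k i‖ - ‖V k j‖)]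

/-- This is why certificates need only entrywise accuracy: an error with entries at most `1 / card
n` changes the expectation in a matrix of trace at most one by at most `1`. -/
theorem _root_.Matrix.PosSemidef.abs_trace_mul_le {A E : Matrix n n ℂ} (hA : A.PosSemidef)
    {ε : ℝ} (hE : ∀ i j, ‖E i j‖ ≤ ε) :
    |(trace (A * E)).re| ≤ ε * Fintype.card n * (trace A).re := by
  refine (Complex.abs_re_le_norm _).trans ?_
  have h1 : ‖trace (A * E)‖ ≤ ∑ i, ∑ j, ((A i i).re + (A j j).re) / 2 * ε := by
    unfold trace
    refine norm_sum_le_of_le _ fun i _ => ?_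
    rw [diag_apply, Matrix.mul_apply]
    refine norm_sum_le_of_le _ fun j _ => ?_
    rw [norm_mul]
    have := hA.norm_apply_le i j
    exact mul_le_mul this (hE j i) (norm_nonneg _) ((norm_nonneg _).trans this)
  refine h1.trans (le_of_eq ?_)
  have h2 : (trace A).re = ∑ i, (A i i).re := by simp [trace]
  simp only [← Finset.sum_mul, ← Finset.sum_div, Finset.sum_add_distrib, Finset.sum_const,
    Finset.card_univ, nsmul_eq_mul, ← Finset.mul_sum]
  rw [h2]
  ring

/-- A positive semidefinite `H` is at most `2 T H T + 2 (1 - T) H (1 - T)`. -/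
theorem _root_.Matrix.PosSemidef.pinching {H T : Matrix n n ℂ} (hH : H.PosSemidef)
    (hT : T.IsHermitian) (a b : ℝ) :
    ((a * a : ℂ) • (T * H * T) + (b * b : ℂ) • ((1 - T) * H * (1 - T)) -
      (a * b : ℂ) • (T * H * (1 - T) + (1 - T) * H * T)).PosSemidef := by
  have h := hH.mul_mul_conjTranspose_same ((a : ℂ) • T - (b : ℂ) • (1 - T))
  have hherm : ((a : ℂ) • T - (b : ℂ) • (1 - T))ᴴ = (a : ℂ) • T - (b : ℂ) • (1 - T) := by
    simp [conjTranspose_sub, conjTranspose_smul, hT.eq]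
  rw [hherm] at h
  convert h using 1
  simp only [Matrix.mul_sub, Matrix.sub_mul, Matrix.mul_smul, Matrix.smul_mul, smul_sub, smul_add,
    smul_smul, Matrix.mul_one, Matrix.one_mul]
  module

omit [DecidableEq n] in
theorem posSemidef_of_isHermitian_of_idempotent {T : Matrix n n ℂ} (hT : T.IsHermitian)
    (hTT : T * T = T) : T.PosSemidef := by
  have := posSemidef_conjTranspose_mul_self T
  rwa [hT.eq, hTT] at this

/-- Pinching splits `ρ` into `T ρ T` and `σ = (1 - T) ρ (1 - T)`. On `σ` the term `c T` vanishes, so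
the size of `c` is irrelevant and `H' ≤ H` costs at most `lam + 1`, with `1` for the error `E`. On
`T ρ T` only `H' ≤ M` is used. Two matrices are needed because in the application the bound on `H`
grows with the stage, while `M` is fixed. -/
theorem trace_re_le_of_domination {H H' T P E ρ : Matrix n n ℂ} {lam M c : ℝ}
    (hH' : H'.PosSemidef) (hHH' : (H - H').PosSemidef)
    (hM : ((M : ℂ) • (1 : Matrix n n ℂ) - H').PosSemidef)
    (hT : T.IsHermitian) (hTT : T * T = T) (hP : P.PosSemidef)
    (hE : ∀ i j, ‖E i j‖ ≤ 1 / Fintype.card n)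
    (hdom : (lam : ℂ) • (1 : Matrix n n ℂ) + (c : ℂ) • T - H - P = E)
    (hlam : 0 ≤ lam) (hρ : ρ.PosSemidef) (hρ1 : ρ.trace = 1) :
    (trace (ρ * H')).re ≤ 2 * M * (trace (ρ * T)).re + 2 * (lam + 1) := by
  have hQ : (1 - T).IsHermitian := isHermitian_one.sub hT
  have hQQ : (1 - T) * (1 - T) = 1 - T := by simp [Matrix.mul_sub, Matrix.sub_mul, hTT]
  have hTQ : T * (1 - T) = 0 := by simp [Matrix.mul_sub, hTT]
  have hTP := posSemidef_of_isHermitian_of_idempotent hT hTT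
  have hσ : ((1 - T) * ρ * (1 - T)).PosSemidef := by
    have := hρ.mul_mul_conjTranspose_same (1 - T); rwa [hQ.eq] at this
  have hτ : (T * ρ * T).PosSemidef := by
    have := hρ.mul_mul_conjTranspose_same T; rwa [hT.eq] at this
  set σ := (1 - T) * ρ * (1 - T) with hσdef
  have hσ1 : (trace σ).re ≤ 1 := by
    have h1 : trace σ = trace ρ - trace (ρ * T) := by
      rw [hσdef, trace_mul_comm, ← Matrix.mul_assoc, hQQ, Matrix.sub_mul, Matrix.one_mul,
        trace_sub, trace_mul_comm T]
    rw [h1, hρ1, Complex.sub_re, Complex.one_re]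
    linarith [hρ.trace_mul_nonneg hTP]
  have hσ0 : 0 ≤ (trace σ).re := (Complex.le_def.1 hσ.trace_nonneg).1
  have hσT : trace (σ * T) = 0 := by
    rw [trace_mul_comm, hσdef, ← Matrix.mul_assoc, ← Matrix.mul_assoc, hTQ]; simp
  have hτT : trace (T * ρ * T) = trace (ρ * T) := by
    rw [trace_mul_comm, ← Matrix.mul_assoc, hTT, trace_mul_comm]
  have hσE : |(trace (σ * E)).re| ≤ 1 := by
    refine (hσ.abs_trace_mul_le hE).trans ?_
    rcases (Fintype.card n).eq_zero_or_pos with h0 | h0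
    · simp [h0]
    · rw [one_div_mul_cancel (by exact_mod_cast h0.ne'), one_mul]; exact hσ1
  have hσH : (trace (σ * H)).re ≤ lam + 1 := by
    have h1 : trace (σ * E) = lam * trace σ + c * trace (σ * T) - trace (σ * H) -
        trace (σ * P) := by
      rw [← hdom]
      simp [Matrix.mul_sub, Matrix.mul_add, trace_sub, trace_add, trace_smul]
    have h2 := congrArg Complex.re h1
    rw [hσT] at h2
    simp only [mul_zero, add_zero, Complex.sub_re, Complex.re_ofReal_mul] at h2
    have h3 := hσ.trace_mul_nonneg hP
    have h4 := (abs_le.1 hσE).1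
    nlinarith
  have hpin : (trace (ρ * H')).re ≤
      2 * (trace (T * ρ * T * H')).re + 2 * (trace (σ * H')).re := by
    have h1 := hρ.trace_mul_nonneg (hH'.pinching hT 1 1)
    -- Since `H'` is the sum of its four blocks, removing the off-diagonal blocks is the same as
    -- doubling the diagonal ones and subtracting `H'`.
    have h2 : (((1 : ℝ) * (1 : ℝ) : ℂ) • (T * H' * T) +
        ((1 : ℝ) * (1 : ℝ) : ℂ) • ((1 - T) * H' * (1 - T)) -
        ((1 : ℝ) * (1 : ℝ) : ℂ) • (T * H' * (1 - T) + (1 - T) * H' * T)) =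
        T * H' * T + T * H' * T + ((1 - T) * H' * (1 - T) + (1 - T) * H' * (1 - T)) - H' := by
      simp only [Matrix.mul_sub, Matrix.sub_mul, Complex.ofReal_one, mul_one, one_smul,
        Matrix.one_mul]
      abel
    have h3 : trace (ρ * (T * H' * T)) = trace (T * ρ * T * H') := by
      rw [trace_mul_comm, Matrix.mul_assoc, Matrix.mul_assoc, trace_mul_comm]
      simp only [Matrix.mul_assoc]
      rw [trace_mul_comm]
      simp only [Matrix.mul_assoc]
    have h4 : trace (ρ * ((1 - T) * H' * (1 - T))) = trace (σ * H') := by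
      rw [hσdef, trace_mul_comm, Matrix.mul_assoc, Matrix.mul_assoc, trace_mul_comm]
      simp only [Matrix.mul_assoc]
      rw [trace_mul_comm]
      simp only [Matrix.mul_assoc]
    rw [h2, Matrix.mul_sub, Matrix.mul_add, Matrix.mul_add, Matrix.mul_add, trace_sub, trace_add,
      trace_add, trace_add, h3, h4] at h1
    simp only [Complex.sub_re, Complex.add_re] at h1
    linarith
  have h5 : (trace (T * ρ * T * H')).re ≤ M * (trace (ρ * T)).re := by
    have := hτ.trace_mul_le hM
    rwa [Matrix.mul_smul, trace_smul, smul_eq_mul, Complex.re_ofReal_mul, Matrix.mul_one,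
      hτT] at this
  have h6 := hσ.trace_mul_le hHH'
  linarith

/-- If `H` is at most `lam` on the kernel of a projection `T`, then `H` is dominated by
`lam + 1` plus a multiple of `T`. -/
theorem posSemidef_domination {H T : Matrix n n ℂ} {lam h : ℝ} (hlam : 0 < lam)
    (hH : H.PosSemidef) (hh : ((h : ℂ) • (1 : Matrix n n ℂ) - H).PosSemidef)
    (hT : T.IsHermitian) (hTT : T * T = T)
    (hker : ∀ x, T *ᵥ x = 0 → (star x ⬝ᵥ H *ᵥ x).re ≤ lam * (star x ⬝ᵥ x).re) :
    (((lam + 1 : ℝ) : ℂ) • (1 : Matrix n n ℂ) + (((1 + lam) * h : ℝ) : ℂ) • T - H).PosSemidef := by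
  have hQ : (1 - T).IsHermitian := isHermitian_one.sub hT
  have hQQ : (1 - T) * (1 - T) = 1 - T := by simp [Matrix.mul_sub, Matrix.sub_mul, hTT]
  have hTQ : T * (1 - T) = 0 := by simp [Matrix.mul_sub, hTT]
  have h1 : ((lam : ℂ) • (1 - T) - (1 - T) * H * (1 - T)).PosSemidef := by
    have hherm : ((lam : ℂ) • (1 - T) - (1 - T) * H * (1 - T)).IsHermitian := by
      have a1 := (hH.mul_mul_conjTranspose_same (1 - T)).isHermitian
      rw [hQ.eq] at a1
      refine IsHermitian.sub ?_ a1
      unfold IsHermitian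
      rw [conjTranspose_smul, hQ.eq]
      simp
    refine PosSemidef.of_dotProduct_mulVec_nonneg hherm fun x => ?_
    have hx := hker ((1 - T) *ᵥ x) (by rw [mulVec_mulVec, hTQ, zero_mulVec])
    have e1 : star ((1 - T) *ᵥ x) ⬝ᵥ H *ᵥ ((1 - T) *ᵥ x) =
        star x ⬝ᵥ ((1 - T) * H * (1 - T)) *ᵥ x := by
      rw [star_mulVec, hQ.eq, ← dotProduct_mulVec]; simp only [mulVec_mulVec, Matrix.mul_assoc]
    have e2 : star ((1 - T) *ᵥ x) ⬝ᵥ ((1 - T) *ᵥ x) = star x ⬝ᵥ (1 - T) *ᵥ x := by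
      rw [star_mulVec, hQ.eq, ← dotProduct_mulVec, mulVec_mulVec, hQQ]
    rw [e1, e2] at hx
    rw [Complex.le_def]
    refine ⟨?_, ?_⟩
    · rw [sub_mulVec, smul_mulVec, dotProduct_sub, dotProduct_smul, smul_eq_mul, Complex.sub_re,
        Complex.re_ofReal_mul, Complex.zero_re]
      linarith
    · exact (hherm.im_star_dotProduct_mulVec_self x).symm
  have h2 : ((h : ℂ) • T - T * H * T).PosSemidef := by
    have := hh.mul_mul_conjTranspose_same T
    rw [hT.eq] at this
    convert this using 1
    simp [Matrix.mul_sub, Matrix.sub_mul, hTT]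
  -- Divided by `lam`, this bounds the cross terms of `H` by `lam T H T + lam⁻¹ (1 - T) H (1 - T)`.
  -- With the diagonal blocks added, `h1` and `h2` give `H ≤ (1 + lam⁻¹) lam (1 - T) + (1 + lam) h
  -- T`; the first coefficient is `lam + 1`, and a further `(lam + 1) T` completes the identity.
  have h3 := hH.pinching hT lam 1
  have hTP := posSemidef_of_isHermitian_of_idempotent hT hTT
  have nn : ∀ r : ℝ, 0 ≤ r → (0 : ℂ) ≤ (r : ℂ) := fun r hr => by exact_mod_cast hr
  have h4 := (h3.smul (nn lam⁻¹ (by positivity))).add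
    (((h1.smul (nn (1 + lam⁻¹) (by positivity))).add (h2.smul (nn (1 + lam) (by positivity)))).add
      (hTP.smul (nn (lam + 1) (by positivity))))
  convert h4 using 1
  have hl : (lam : ℂ) ≠ 0 := by exact_mod_cast hlam.ne'
  simp only [Matrix.mul_sub, Matrix.sub_mul, Matrix.mul_one, Matrix.one_mul]
  push_cast
  match_scalars <;> field_simp <;> ring

end LinearAlgebra

/-! ### Projections with Gaussian rational entries -/

/-- The denominator of the `k`-th approximation is prescribed to be `k`, so that all entries of a
matrix can share one denominator, which may also be restricted to multiples of a given number. -/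
theorem exists_tendsto_gaussian (z : ℂ) : ∃ q : ℕ → GaussianInt,
    Tendsto (fun k : ℕ => GaussianInt.toComplex (q k) / k) atTop (𝓝 z) := by
  choose q _ hq using fun k : ℕ => exists_gaussian_trunc ((k : ℂ) * z)
  refine ⟨q, tendsto_iff_norm_sub_tendsto_zero.2 ?_⟩
  refine squeeze_zero' (Eventually.of_forall fun _ => norm_nonneg _) ?_
    (tendsto_const_div_atTop_nhds_zero_nat (2 : ℝ))
  filter_upwards [eventually_gt_atTop 0] with k hk
  have hk' : (k : ℂ) ≠ 0 := by exact_mod_cast hk.ne'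
  have hk0 : (0 : ℝ) < k := by exact_mod_cast hk
  have h : GaussianInt.toComplex (q k) / k - z = -(k * z - GaussianInt.toComplex (q k)) / k := by
    field_simp; ring
  rw [h, norm_div, norm_neg, Complex.norm_natCast]
  gcongr
  exact (hq k).le

section

variable {n : Type*} [Fintype n] [DecidableEq n]

/-- An orthogonal projection with Gaussian rational entries. -/
structure IsGaussianProj (T : Matrix n n ℂ) : Prop where
  isHermitian : T.IsHermitian
  isIdempotent : T * T = T
  exists_denom : ∃ d : ℕ, 0 < d ∧ ∃ A : Matrix n n GaussianInt,
    (d : ℂ) • T = A.map GaussianInt.toComplex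

theorem IsGaussianProj.trace_le_card {T : Matrix n n ℂ} (hT : IsGaussianProj T) :
    (trace T).re ≤ Fintype.card n := by
  have h := posSemidef_of_isHermitian_of_idempotent (isHermitian_one.sub hT.isHermitian)
    (by simp [Matrix.mul_sub, Matrix.sub_mul, hT.isIdempotent])
  have := (Complex.le_def.1 h.trace_nonneg).1
  rw [trace_sub, trace_one, Complex.sub_re] at this
  simpa using this

/-- A Gaussian rational projection can be enlarged by one dimension within any open condition on
the direction. -/
theorem IsGaussianProj.exists_extend {T H : Matrix n n ℂ} (hT : IsGaussianProj T) {lam : ℝ}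
    {x : n → ℂ} (hx : T *ᵥ x = 0) (hlt : lam * (star x ⬝ᵥ x).re < (star x ⬝ᵥ H *ᵥ x).re) :
    ∃ T' : Matrix n n ℂ, IsGaussianProj T' ∧ T' * T = T ∧ (trace T').re = (trace T).re + 1 ∧
      (trace (T * H)).re + lam < (trace (T' * H)).re := by
  obtain ⟨d, hd, A, hA⟩ := hT.exists_denom
  choose w hw using fun i => exists_tendsto_gaussian (x i)
  have hw' : Tendsto (fun k : ℕ => fun i => GaussianInt.toComplex (w i k) / (k : ℂ)) atTop
      (𝓝 x) := tendsto_pi_nhds.2 hw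
  -- The excess over `lam` in the direction `(1 - T) y` is continuous in `y` and positive at `y =
  -- x`, where `(1 - T) x = x`. So it stays positive at a Gaussian rational `y`, and projecting
  -- keeps the new direction exactly orthogonal to `T`.
  have hcont : Continuous fun y : n → ℂ =>
      (star ((1 - T) *ᵥ y) ⬝ᵥ H *ᵥ ((1 - T) *ᵥ y)).re -
        lam * (star ((1 - T) *ᵥ y) ⬝ᵥ ((1 - T) *ᵥ y)).re := by
    fun_prop
  have hlim := (hcont.tendsto x).comp hw'
  have hxT : (1 - T) *ᵥ x = x := by rw [sub_mulVec, one_mulVec, hx, sub_zero]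
  rw [hxT] at hlim
  obtain ⟨k, hk, hk0⟩ := ((hlim.eventually (lt_mem_nhds (sub_pos.2 hlt))).and
    (eventually_gt_atTop 0)).exists
  have hkC : (k : ℂ) ≠ 0 := by exact_mod_cast hk0.ne'
  have hdC : (d : ℂ) ≠ 0 := by exact_mod_cast hd.ne'
  simp only [Function.comp_apply] at hk
  set y : n → ℂ := fun i => GaussianInt.toComplex (w i k) / k with hy
  let u : n → GaussianInt := ((d : GaussianInt) • (1 : Matrix n n GaussianInt) - A) *ᵥ
    fun i => w i k
  let U : n → ℂ := fun i => GaussianInt.toComplex (u i)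
  have hmap : ((d : GaussianInt) • (1 : Matrix n n GaussianInt) - A).map GaussianInt.toComplex =
      (d : ℂ) • (1 - T) := by
    rw [smul_sub, hA]
    ext i j
    by_cases hij : i = j <;> simp [hij]
  have hU : U = ((d : ℂ) * k) • ((1 - T) *ᵥ y) := by
    have h1 : U = ((d : GaussianInt) • (1 : Matrix n n GaussianInt) - A).map
        GaussianInt.toComplex *ᵥ fun i => GaussianInt.toComplex (w i k) := by
      ext i
      exact RingHom.map_mulVec GaussianInt.toComplex _ _ i
    have h2 : (fun i => GaussianInt.toComplex (w i k)) = (k : ℂ) • y := by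
      ext i; simp only [hy, Pi.smul_apply, smul_eq_mul]; field_simp
    rw [h1, hmap, h2, mulVec_smul, smul_mulVec, smul_smul, mul_comm (k : ℂ)]
  have hTU : T *ᵥ U = 0 := by
    rw [hU, mulVec_smul, mulVec_mulVec, Matrix.mul_sub, hT.isIdempotent, Matrix.mul_one, sub_self,
      zero_mulVec, smul_zero]
  have hscale : ∀ B : Matrix n n ℂ, (star U ⬝ᵥ B *ᵥ U).re =
      ((d : ℝ) * k) ^ 2 * (star ((1 - T) *ᵥ y) ⬝ᵥ B *ᵥ ((1 - T) *ᵥ y)).re := by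
    intro B
    rw [hU, star_smul, mulVec_smul, smul_dotProduct, dotProduct_smul, smul_smul, smul_eq_mul]
    have : star ((d : ℂ) * k) * ((d : ℂ) * k) = ((((d : ℝ) * k) ^ 2 : ℝ) : ℂ) := by
      simp; ring
    rw [this, Complex.re_ofReal_mul]
  have hUlt : lam * (star U ⬝ᵥ U).re < (star U ⬝ᵥ H *ᵥ U).re := by
    have h1 := hscale 1
    rw [one_mulVec, one_mulVec] at h1
    rw [h1, hscale H]
    have : 0 < ((d : ℝ) * k) ^ 2 := by positivity
    nlinarith
  -- `U` has Gaussian integer entries, so its squared length is a natural number, and the projection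
  -- `U Uᴴ / ν` onto its line is Gaussian rational without any square root.
  obtain ⟨ν, hν⟩ : ∃ ν : ℕ, star U ⬝ᵥ U = ν := by
    refine ⟨∑ i, (u i).norm.natAbs, ?_⟩
    rw [Nat.cast_sum, dotProduct]
    refine Finset.sum_congr rfl fun i _ => ?_
    have h1 := norm_natAbs_eq (u i)
    rw [Pi.star_apply, Complex.star_def, ← Complex.normSq_eq_conj_mul_self,
      Complex.normSq_eq_norm_sq, ← h1]
    simp
  have hν0 : 0 < ν := by
    rcases Nat.eq_zero_or_pos ν with h0 | h0
    · rw [h0, Nat.cast_zero, dotProduct_star_self_eq_zero] at hν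
      simp [hν] at hUlt
    · exact h0
  have hνC : (ν : ℂ) ≠ 0 := by exact_mod_cast hν0.ne'
  have hνR : (0 : ℝ) < ν := by exact_mod_cast hν0
  have hTv : T * vecMulVec U (star U) = 0 := by rw [mul_vecMulVec, hTU, zero_vecMulVec]
  have hvh : (vecMulVec U (star U))ᴴ = vecMulVec U (star U) := by
    rw [conjTranspose_vecMulVec, star_star]
  have hvT : vecMulVec U (star U) * T = 0 := by
    have := congrArg conjTranspose hTv
    rwa [conjTranspose_mul, hvh, hT.isHermitian.eq, conjTranspose_zero] at this
  have hvv : vecMulVec U (star U) * vecMulVec U (star U) = (ν : ℂ) • vecMulVec U (star U) := by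
    rw [vecMulVec_mul_vecMulVec, hν, vecMulVec_smul]
  have htr : trace (vecMulVec U (star U) * H) = star U ⬝ᵥ H *ᵥ U := by
    rw [vecMulVec_mul, trace_vecMulVec, dotProduct_comm, dotProduct_mulVec]
  refine ⟨T + (ν : ℂ)⁻¹ • vecMulVec U (star U), ⟨?_, ?_, d * ν, by positivity,
    (ν : GaussianInt) • A + (d : GaussianInt) • vecMulVec u (star u), ?_⟩, ?_, ?_, ?_⟩
  · refine hT.isHermitian.add ?_
    unfold IsHermitian
    rw [conjTranspose_smul, hvh]
    simp
  · rw [Matrix.mul_add, Matrix.add_mul, Matrix.add_mul, hT.isIdempotent, Matrix.smul_mul, hvT,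
      Matrix.mul_smul, hTv, Matrix.smul_mul, Matrix.mul_smul, hvv, smul_smul, smul_smul,
      mul_assoc, inv_mul_cancel₀ hνC]
    simp
  · ext i j
    have h1 := congrFun (congrFun hA i) j
    simp only [Matrix.smul_apply, smul_eq_mul, map_apply, Matrix.add_apply, vecMulVec_apply, Pi.star_apply,
      map_add, map_mul, map_natCast, GaussianInt.toComplex_star] at h1 ⊢
    rw [← h1]
    simp only [U, Complex.star_def]
    push_cast
    field_simp
  · rw [Matrix.add_mul, hT.isIdempotent, Matrix.smul_mul, hvT, smul_zero, add_zero]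
  · rw [trace_add, trace_smul, trace_vecMulVec, dotProduct_comm, hν, smul_eq_mul,
      inv_mul_cancel₀ hνC]
    simp
  · rw [Matrix.add_mul, trace_add, Matrix.smul_mul, trace_smul, htr, smul_eq_mul, Complex.add_re,
      show ((ν : ℂ)⁻¹) = (((ν : ℝ)⁻¹ : ℝ) : ℂ) by push_cast; rfl, Complex.re_ofReal_mul]
    rw [hν, Complex.natCast_re] at hUlt
    have : lam < (ν : ℝ)⁻¹ * (star U ⬝ᵥ H *ᵥ U).re := by
      rw [inv_mul_eq_div, lt_div_iff₀ hνR]; exact hUlt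
    linarith

/-- A Gaussian rational projection extends to one outside of which `H` is at most `lam`. -/
theorem IsGaussianProj.exists_maximal {T H : Matrix n n ℂ} (hT : IsGaussianProj T) {lam C : ℝ}
    (hC : lam * (trace T).re < (trace (T * H)).re + C) :
    ∃ T' : Matrix n n ℂ, IsGaussianProj T' ∧ T' * T = T ∧
      lam * (trace T').re < (trace (T' * H)).re + C ∧
      ∀ x, T' *ᵥ x = 0 → (star x ⬝ᵥ H *ᵥ x).re ≤ lam * (star x ⬝ᵥ x).re := by
  -- Induction on a bound for the codimension `card n - tr T`: each extension raises the trace by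
  -- one, and no Gaussian projection has trace above `card n`.
  suffices h : ∀ k : ℕ, ∀ T : Matrix n n ℂ, IsGaussianProj T →
      lam * (trace T).re < (trace (T * H)).re + C → Fintype.card n - (trace T).re < k →
      ∃ T' : Matrix n n ℂ, IsGaussianProj T' ∧ T' * T = T ∧
        lam * (trace T').re < (trace (T' * H)).re + C ∧
        ∀ x, T' *ᵥ x = 0 → (star x ⬝ᵥ H *ᵥ x).re ≤ lam * (star x ⬝ᵥ x).re by
    obtain ⟨k, hk⟩ := exists_nat_gt (Fintype.card n - (trace T).re)
    exact h k T hT hC hk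
  intro k
  induction k with
  | zero =>
    intro T hT _ hk
    have := hT.trace_le_card
    simp only [Nat.cast_zero] at hk
    linarith
  | succ k ih =>
    intro T hT hC hk
    by_cases hmax : ∀ x, T *ᵥ x = 0 → (star x ⬝ᵥ H *ᵥ x).re ≤ lam * (star x ⬝ᵥ x).re
    · exact ⟨T, hT, hT.isIdempotent, hC, hmax⟩
    · push Not at hmax
      obtain ⟨x, hx, hlt⟩ := hmax
      obtain ⟨T₁, hT₁, hT₁T, htr, hH⟩ := hT.exists_extend hx hlt
      push_cast at hk
      obtain ⟨T₂, hT₂, hT₂T, h3, h4⟩ := ih T₁ hT₁ (by rw [htr]; linarith) (by rw [htr]; linarith)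
      exact ⟨T₂, hT₂, by rw [← hT₁T, ← Matrix.mul_assoc, hT₂T], h3, h4⟩

end

/-! ### Decidable certificates for projections that dominate a given matrix -/

/-- The entry `(i, j)` of an infinite matrix with finitely many nonzero entries. -/
def listEntry (L : List GaussianInt) (i j : ℕ) : GaussianInt := L.getD (Nat.pair i j) 0

/-- The upper left corner of size `N`, as a complex matrix. -/
def listMatrix (N : ℕ) (L : List GaussianInt) : Matrix (Fin N) (Fin N) ℂ :=
  Matrix.of fun i j => GaussianInt.toComplex (listEntry L i j)

theorem exists_listEntry_eq (N : ℕ) (F : Matrix (Fin N) (Fin N) GaussianInt) :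
    ∃ L, ∀ i j : Fin N, listEntry L i j = F i j := by
  let G : ℕ → GaussianInt := fun k =>
    if h : k.unpair.1 < N ∧ k.unpair.2 < N then F ⟨_, h.1⟩ ⟨_, h.2⟩ else 0
  refine ⟨(List.range ((N + 1) ^ 2)).map G, fun i j => ?_⟩
  have hlt : Nat.pair i j < (N + 1) ^ 2 := by
    refine (Nat.pair_lt_max_add_one_sq _ _).trans_le ?_
    gcongr
    exact max_le i.2.le j.2.le
  simp [listEntry, List.getD_eq_getElem?_getD, List.getElem?_map, List.getElem?_range hlt, G]

/-- A candidate for a certificate: a denominator, and the numerators of two matrices. -/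
abbrev ProjCert : Type := ℕ × List GaussianInt × List GaussianInt

/-- The projection of a certificate. -/
def ProjCert.proj (W : ProjCert) (N : ℕ) : Matrix (Fin N) (Fin N) ℂ :=
  (W.1 : ℂ)⁻¹ • listMatrix N W.2.1

/-- `W = (d, A, B)` certifies that `A / d` is a projection, that a matrix approximated by
`h / d` up to `K / d` is on average almost `lam` on the range of `A / d`, and that it is, up to the
positive semidefinite `(B / d)ᴴ (B / d)`, dominated by `lam + 1 + c A / d`. -/
def ProjCert.Valid (h : ℕ → ℕ → ℕ → GaussianInt) (N K lam c : ℕ) (W : ProjCert) : Prop :=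
  0 < W.1 ∧
  (∀ i < N, ∀ j < N, star (listEntry W.2.1 i j) = listEntry W.2.1 j i) ∧
  (∀ i < N, ∀ j < N, ∑ k ∈ Finset.range N, listEntry W.2.1 i k * listEntry W.2.1 k j =
    (W.1 : GaussianInt) * listEntry W.2.1 i j) ∧
  (((lam * W.1 : ℕ) : GaussianInt) * ∑ i ∈ Finset.range N, listEntry W.2.1 i i).re +
      ((N * N * K * W.1 : ℕ) : ℤ) <
    (∑ i ∈ Finset.range N, ∑ j ∈ Finset.range N, listEntry W.2.1 i j * h j i W.1).re +
      ((N * W.1 * W.1 : ℕ) : ℤ) ∧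
  (∀ i < N, ∀ j < N, (2 * N) ^ 2 * (((W.1 * W.1 * (lam + 1) * (if i = j then 1 else 0) : ℕ) :
      GaussianInt) + ((c * W.1 : ℕ) : GaussianInt) * listEntry W.2.1 i j -
      (W.1 : GaussianInt) * h i j W.1 - ∑ k ∈ Finset.range N,
        star (listEntry W.2.2 k i) * listEntry W.2.2 k j).norm.natAbs ≤ (W.1 * W.1) ^ 2) ∧
  2 * N * K ≤ W.1

theorem forall_lt_iff_fin {N : ℕ} {p : ℕ → ℕ → Prop} :
    (∀ i < N, ∀ j < N, p i j) ↔ ∀ i j : Fin N, p i j :=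
  ⟨fun h i j => h i i.2 j j.2, fun h i hi j hj => h ⟨i, hi⟩ ⟨j, hj⟩⟩

/-- The clauses of `Valid` are cleared of denominators, and the entrywise bound is squared, so that
only integers are compared. Here they return to statements about complex matrices. -/
theorem ProjCert.valid_iff {h : ℕ → ℕ → ℕ → GaussianInt} {N K lam c : ℕ} {W : ProjCert} :
    W.Valid h N K lam c ↔ 0 < W.1 ∧ (listMatrix N W.2.1).IsHermitian ∧
      listMatrix N W.2.1 * listMatrix N W.2.1 = (W.1 : ℂ) • listMatrix N W.2.1 ∧
      (lam : ℝ) * W.1 * (trace (listMatrix N W.2.1)).re + N * N * K * W.1 <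
        (trace (listMatrix N W.2.1 *
          Matrix.of fun i j : Fin N => GaussianInt.toComplex (h i j W.1))).re + N * W.1 * W.1 ∧
      (∀ i j : Fin N, 2 * N * ‖((W.1 * W.1 * (lam + 1) : ℂ) • (1 : Matrix (Fin N) (Fin N) ℂ) +
        (c * W.1 : ℂ) • listMatrix N W.2.1 -
        (W.1 : ℂ) • (Matrix.of fun i j : Fin N => GaussianInt.toComplex (h i j W.1)) -
        (listMatrix N W.2.2)ᴴ * listMatrix N W.2.2) i j‖ ≤ (W.1 : ℝ) * W.1) ∧
      2 * N * K ≤ W.1 := by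
  unfold ProjCert.Valid
  refine and_congr_right fun _ => and_congr ?_ (and_congr ?_ (and_congr ?_ (and_congr_left
    fun _ => ?_)))
  · rw [forall_lt_iff_fin, IsHermitian.ext_iff, forall_comm]
    refine forall₂_congr fun i j => ?_
    rw [← GaussianInt.toComplex_inj, GaussianInt.toComplex_star]
    rfl
  · rw [forall_lt_iff_fin, ← Matrix.ext_iff]
    refine forall₂_congr fun i j => ?_
    rw [← GaussianInt.toComplex_inj, map_sum, map_mul, map_natCast, Finset.sum_range,
      Matrix.mul_apply]
    simp [listMatrix]
  · rw [← Int.cast_lt (R := ℝ)]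
    push_cast
    rw [GaussianInt.intCast_re, GaussianInt.intCast_re, map_mul, map_sum, map_sum,
      Finset.sum_range, Finset.sum_range]
    have h1 : ∀ i : Fin N, GaussianInt.toComplex (∑ j ∈ Finset.range N,
        listEntry W.2.1 i j * h j i W.1) =
        (listMatrix N W.2.1 * Matrix.of fun i j : Fin N => GaussianInt.toComplex (h i j W.1)) i i :=
      fun i => by simp [Matrix.mul_apply, listMatrix, Finset.sum_range]
    have h2 : (GaussianInt.toComplex ((lam : GaussianInt) * (W.1 : GaussianInt)) *
        ∑ i : Fin N, GaussianInt.toComplex (listEntry W.2.1 i i)).re =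
        (lam : ℝ) * W.1 * (trace (listMatrix N W.2.1)).re := by
      rw [map_mul, map_natCast, map_natCast, ← Nat.cast_mul, ← Complex.ofReal_natCast,
        Complex.re_ofReal_mul, Nat.cast_mul]
      rfl
    simp only [h1]
    rw [h2]
    rfl
  · rw [forall_lt_iff_fin]
    refine forall₂_congr fun i j => ?_
    rw [← Nat.cast_le (α := ℝ)]
    push_cast
    rw [norm_natAbs_eq, ← mul_pow, sq_le_sq₀ (by positivity) (by positivity)]
    have h1 : ∀ x : GaussianInt, ∀ y : ℂ, GaussianInt.toComplex x = y →
        (2 * (N : ℝ) * ‖GaussianInt.toComplex x‖ ≤ W.1 * W.1 ↔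
          2 * (N : ℝ) * ‖y‖ ≤ W.1 * W.1) := fun x y hxy => by rw [hxy]
    refine h1 _ _ ?_
    by_cases hij : i = j
    · subst hij
      simp [listMatrix, Finset.sum_range, Matrix.mul_apply]
    · have hij' : (i : ℕ) ≠ j := fun h => hij (Fin.ext h)
      simp [listMatrix, Finset.sum_range, Matrix.mul_apply, hij, hij']

theorem IsGaussianProj.norm_apply_le_one {N : ℕ} {T : Matrix (Fin N) (Fin N) ℂ}
    (hT : T.IsHermitian) (hTT : T * T = T) (i j : Fin N) : ‖T i j‖ ≤ 1 := by
  have h1 := (posSemidef_of_isHermitian_of_idempotent hT hTT).norm_apply_le i j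
  have h2 := posSemidef_of_isHermitian_of_idempotent (isHermitian_one.sub hT)
    (by simp [Matrix.mul_sub, Matrix.sub_mul, hTT])
  have h3 : ∀ i, (T i i).re ≤ 1 := fun i => by
    have := (Complex.le_def.1 (h2.diag_nonneg (i := i))).1
    simpa using this
  linarith [h3 i, h3 j]

/-- The clauses speak of the approximation `h`, with room to replace it by `d H`. The term `N * N *
K * d` absorbs the change of the trace, as entries of a projection have norm at most one. In the
domination the clause itself allows `1 / (2 N)`, and `2 * N * K ≤ d` allows another `1 / (2 N)` for
the approximation. -/
theorem ProjCert.Valid.sound {h : ℕ → ℕ → ℕ → GaussianInt} {N K lam c : ℕ} {W : ProjCert}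
    (hW : W.Valid h N K lam c) (hN : 0 < N) {H : Matrix (Fin N) (Fin N) ℂ}
    (hH : ∀ d : ℕ, 0 < d → ∀ i j : Fin N, ‖(d : ℂ) * H i j - GaussianInt.toComplex (h i j d)‖ ≤ K) :
    IsGaussianProj (W.proj N) ∧
    (lam : ℝ) * (trace (W.proj N)).re < (trace (W.proj N * H)).re + N ∧
    ∃ P : Matrix (Fin N) (Fin N) ℂ, P.PosSemidef ∧ ∀ i j,
      ‖((lam + 1 : ℂ) • (1 : Matrix (Fin N) (Fin N) ℂ) + (c : ℂ) • W.proj N - H - P) i j‖ ≤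
        1 / N := by
  obtain ⟨hd, hA, hAA, htr, hdom, hK⟩ := ProjCert.valid_iff.1 hW
  set d := W.1 with hddef
  set A := listMatrix N W.2.1 with hAdef
  set B := listMatrix N W.2.2
  set G : Matrix (Fin N) (Fin N) ℂ :=
    Matrix.of fun i j : Fin N => GaussianInt.toComplex (h i j d) with hGdef
  have hdC : (d : ℂ) ≠ 0 := by exact_mod_cast hd.ne'
  have hdR : (0 : ℝ) < d := by exact_mod_cast hd
  have hNR : (0 : ℝ) < N := by exact_mod_cast hN
  have hAT : A = (d : ℂ) • W.proj N := by
    rw [ProjCert.proj, smul_smul, mul_inv_cancel₀ hdC, one_smul]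
  set T := W.proj N with hTdef
  have hT : T.IsHermitian := by
    rw [hTdef, ProjCert.proj]
    unfold IsHermitian
    rw [conjTranspose_smul, hA.eq, star_inv₀, Complex.star_def, Complex.conj_natCast]
  have hTT : T * T = T := by
    have h1 : (d : ℂ) • (d : ℂ) • (T * T) = (d : ℂ) • (d : ℂ) • T := by
      rw [← hAT, ← hAA, hAT, Matrix.smul_mul, Matrix.mul_smul]
    exact smul_right_injective _ hdC (smul_right_injective _ hdC h1)
  have hG : ∀ i j, ‖((d : ℂ) • H - G) i j‖ ≤ K := fun i j => by
    simpa [hGdef] using hH d hd i j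
  refine ⟨⟨hT, hTT, d, hd, Matrix.of fun i j => listEntry W.2.1 i j, ?_⟩, ?_, ?_⟩
  · rw [← hAT]; rfl
  · have h1 : |(trace (A * ((d : ℂ) • H - G))).re| ≤ N * N * K * d := by
      refine (Complex.abs_re_le_norm _).trans ?_
      have h2 : ‖trace (A * ((d : ℂ) • H - G))‖ ≤ ∑ _i : Fin N, ∑ _j : Fin N, (d : ℝ) * K := by
        unfold trace
        refine norm_sum_le_of_le _ fun i _ => ?_
        rw [diag_apply, Matrix.mul_apply]
        refine norm_sum_le_of_le _ fun j _ => ?_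
        rw [norm_mul]
        refine mul_le_mul ?_ (hG j i) (norm_nonneg _) hdR.le
        rw [hAT, Matrix.smul_apply, norm_smul, Complex.norm_natCast]
        exact mul_le_of_le_one_right hdR.le (IsGaussianProj.norm_apply_le_one hT hTT i j)
      refine h2.trans (le_of_eq ?_)
      simp
      ring
    have h3 : (trace (A * ((d : ℂ) • H - G))).re =
        (d : ℝ) * d * (trace (T * H)).re - (trace (A * G)).re := by
      rw [Matrix.mul_sub, trace_sub, Complex.sub_re, hAT, Matrix.smul_mul, Matrix.mul_smul,
        smul_smul, trace_smul, smul_eq_mul]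
      congr 1
      rw [← Nat.cast_mul, ← Complex.ofReal_natCast, Complex.re_ofReal_mul, Nat.cast_mul]
    have h4 : (trace A).re = d * (trace T).re := by
      rw [hAT, trace_smul, smul_eq_mul, ← Complex.ofReal_natCast, Complex.re_ofReal_mul]
    rw [h4] at htr
    have h5 := (abs_le.1 h1).1
    rw [h3] at h5
    have h6 : (d : ℝ) * d * (lam * (trace T).re) < d * d * ((trace (T * H)).re + N) := by
      nlinarith
    exact lt_of_mul_lt_mul_left h6 (by positivity)
  · refine ⟨((d : ℂ)⁻¹ • B)ᴴ * ((d : ℂ)⁻¹ • B), posSemidef_conjTranspose_mul_self _,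
      fun i j => ?_⟩
    have h1 := hdom i j
    have h2 := hG i j
    set X := (d * d * (lam + 1) : ℂ) • (1 : Matrix (Fin N) (Fin N) ℂ) + (c * d : ℂ) • A -
        (d : ℂ) • G - Bᴴ * B with hX
    have h3 : ((lam + 1 : ℂ) • (1 : Matrix (Fin N) (Fin N) ℂ) + (c : ℂ) • T - H -
        ((d : ℂ)⁻¹ • B)ᴴ * ((d : ℂ)⁻¹ • B)) =
        ((d : ℂ) * d)⁻¹ • (X - (d : ℂ) • ((d : ℂ) • H - G)) := by
      rw [hX, hAT, conjTranspose_smul, Matrix.smul_mul, Matrix.mul_smul, star_inv₀,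
        Complex.star_def, Complex.conj_natCast]
      match_scalars <;> field_simp
      all_goals ring
    rw [h3, Matrix.smul_apply, norm_smul, norm_inv, norm_mul, Complex.norm_natCast,
      inv_mul_eq_div, div_le_div_iff₀ (by positivity) hNR]
    have h4 : ‖(X - (d : ℂ) • ((d : ℂ) • H - G)) i j‖ ≤ ‖X i j‖ + d * K := by
      rw [Matrix.sub_apply, Matrix.smul_apply]
      refine (norm_sub_le _ _).trans ?_
      rw [norm_smul, Complex.norm_natCast]
      gcongr
    have h5 : 2 * (N : ℝ) * K ≤ d := by exact_mod_cast hK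
    nlinarith

/-- Extend `T₀` to a maximal `T` and write the positive matrix of the domination as `Vᴴ V`. As the
denominator grows, the approximations of `H` and `V` converge: the trace clause is strict in the
limit and the domination error tends to `0`, so all clauses hold eventually. The coefficient `(1 +
lam) * b` is explicit because validity has to be decidable. -/
theorem ProjCert.exists_valid {h : ℕ → ℕ → ℕ → GaussianInt} {N K lam b : ℕ} (hlam : 0 < lam)
    (hN : 0 < N) {H : Matrix (Fin N) (Fin N) ℂ} (hH : H.PosSemidef)
    (hb : ((b : ℂ) • (1 : Matrix (Fin N) (Fin N) ℂ) - H).PosSemidef)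
    (happrox : ∀ d : ℕ, 0 < d → ∀ i j : Fin N,
      ‖(d : ℂ) * H i j - GaussianInt.toComplex (h i j d)‖ ≤ K)
    {T₀ : Matrix (Fin N) (Fin N) ℂ} (hT₀ : IsGaussianProj T₀)
    (htr₀ : (lam : ℝ) * (trace T₀).re < (trace (T₀ * H)).re + N) :
    ∃ W : ProjCert, W.Valid h N K lam ((1 + lam) * b) ∧ W.proj N * T₀ = T₀ := by
  obtain ⟨T, hT, hTT₀, htr, hker⟩ := hT₀.exists_maximal htr₀
  obtain ⟨d₀, hd₀, A₀, hA₀⟩ := hT.exists_denom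
  have hNR : (0 : ℝ) < N := by exact_mod_cast hN
  have hdomP := posSemidef_domination (h := b) (Nat.cast_pos.2 hlam) hH (by simpa using hb)
    hT.isHermitian hT.isIdempotent hker
  obtain ⟨V, hV⟩ := hdomP.exists_eq_conjTranspose_mul_self
  choose q hq using fun i j => exists_tendsto_gaussian (V i j)
  -- Only multiples of `d₀` serve as denominators, so that `d T` has Gaussian integer entries and
  -- the projection clauses hold exactly.
  have htop : Tendsto (fun m : ℕ => d₀ * m) atTop atTop :=
    tendsto_id.const_mul_atTop' hd₀
  let G : ℕ → Matrix (Fin N) (Fin N) ℂ := fun d => Matrix.of fun i j =>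
    GaussianInt.toComplex (h i j d)
  let B : ℕ → Matrix (Fin N) (Fin N) ℂ := fun d => Matrix.of fun i j =>
    GaussianInt.toComplex (q i j d)
  have hG : Tendsto (fun d : ℕ => (d : ℂ)⁻¹ • G d) atTop (𝓝 H) := by
    refine tendsto_pi_nhds.2 fun i => tendsto_pi_nhds.2 fun j => ?_
    refine tendsto_iff_norm_sub_tendsto_zero.2 ?_
    refine squeeze_zero' (Eventually.of_forall fun _ => norm_nonneg _) ?_
      (tendsto_const_div_atTop_nhds_zero_nat (K : ℝ))
    filter_upwards [eventually_gt_atTop 0] with d hd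
    have hdC : (d : ℂ) ≠ 0 := by exact_mod_cast hd.ne'
    have hdR : (0 : ℝ) < d := by exact_mod_cast hd
    have : ((d : ℂ)⁻¹ • G d) i j - H i j =
        -((d : ℂ) * H i j - GaussianInt.toComplex (h i j d)) / d := by
      simp only [G, Matrix.smul_apply, Matrix.of_apply, smul_eq_mul]
      field_simp
      ring
    rw [this, norm_div, norm_neg, Complex.norm_natCast]
    gcongr
    exact happrox d hd i j
  have hB : Tendsto (fun d : ℕ => (d : ℂ)⁻¹ • B d) atTop (𝓝 V) := by
    refine tendsto_pi_nhds.2 fun i => tendsto_pi_nhds.2 fun j => ?_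
    refine (hq i j).congr fun d => ?_
    simp only [B, Matrix.smul_apply, Matrix.of_apply, smul_eq_mul]
    rw [inv_mul_eq_div]
  have hlim4 : Tendsto (fun d : ℕ => (trace (T * ((d : ℂ)⁻¹ • G d))).re + N -
      (N * N * K : ℝ) / d) atTop (𝓝 ((trace (T * H)).re + N - 0)) := by
    refine Tendsto.sub (Tendsto.add ?_ tendsto_const_nhds)
      (tendsto_const_div_atTop_nhds_zero_nat _)
    have : Continuous fun X : Matrix (Fin N) (Fin N) ℂ => (trace (T * X)).re := by fun_prop
    exact (this.tendsto H).comp hG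
  have hlim5 : Tendsto (fun d : ℕ => (lam + 1 : ℂ) • (1 : Matrix (Fin N) (Fin N) ℂ) +
      (((1 + lam) * b : ℕ) : ℂ) • T - (d : ℂ)⁻¹ • G d -
        ((d : ℂ)⁻¹ • B d)ᴴ * ((d : ℂ)⁻¹ • B d)) atTop (𝓝 0) := by
    have h1 : Continuous fun X : Matrix (Fin N) (Fin N) ℂ => Xᴴ * X := by fun_prop
    have h2 := (hG.const_sub ((lam + 1 : ℂ) • (1 : Matrix (Fin N) (Fin N) ℂ) +
      (((1 + lam) * b : ℕ) : ℂ) • T)).sub ((h1.tendsto V).comp hB)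
    rw [← hV] at h2
    refine h2.trans_eq ?_
    congr 1
    push_cast
    exact sub_self _
  have hev5 : ∀ᶠ d : ℕ in atTop, ∀ i j, 2 * N * ‖((lam + 1 : ℂ) •
      (1 : Matrix (Fin N) (Fin N) ℂ) + (((1 + lam) * b : ℕ) : ℂ) • T - (d : ℂ)⁻¹ • G d -
        ((d : ℂ)⁻¹ • B d)ᴴ * ((d : ℂ)⁻¹ • B d)) i j‖ ≤ 1 := by
    rw [eventually_all]; intro i
    rw [eventually_all]; intro j
    have h1 := ((tendsto_pi_nhds.1 (tendsto_pi_nhds.1 hlim5 i) j).norm).const_mul (2 * (N : ℝ))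
    simp only [Matrix.zero_apply, norm_zero, mul_zero] at h1
    exact (h1.eventually (gt_mem_nhds one_pos)).mono fun d hd => hd.le
  have hev4 : ∀ᶠ d : ℕ in atTop, (lam : ℝ) * (trace T).re <
      (trace (T * ((d : ℂ)⁻¹ • G d))).re + N - (N * N * K : ℝ) / d :=
    hlim4.eventually (lt_mem_nhds (by rw [sub_zero]; exact htr))
  obtain ⟨m, ⟨⟨h4, h5⟩, h6⟩, hm⟩ := ((htop.eventually ((hev4.and hev5).and
    (eventually_ge_atTop (2 * N * K)))).and (eventually_gt_atTop 0)).exists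
  set d := d₀ * m with hd
  have hd0 : 0 < d := Nat.mul_pos hd₀ hm
  have hdC : (d : ℂ) ≠ 0 := by exact_mod_cast hd0.ne'
  have hdR : (0 : ℝ) < d := by exact_mod_cast hd0
  obtain ⟨LA, hLA⟩ := exists_listEntry_eq N ((m : GaussianInt) • A₀)
  obtain ⟨LB, hLB⟩ := exists_listEntry_eq N (Matrix.of fun i j => q i j d)
  have hA : listMatrix N LA = (d : ℂ) • T := by
    ext i j
    have h1 := congrFun (congrFun hA₀ i) j
    simp only [Matrix.smul_apply, smul_eq_mul, Matrix.map_apply] at h1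
    simp only [listMatrix, Matrix.of_apply, hLA, Matrix.smul_apply, smul_eq_mul, map_mul,
      map_natCast, ← h1, hd]
    push_cast
    ring
  have hBd : listMatrix N LB = B d := by
    ext i j
    simp only [listMatrix, Matrix.of_apply, hLB, B]
  refine ⟨(d, LA, LB), ProjCert.valid_iff.2 ⟨hd0, ?_, ?_, ?_, ?_, h6⟩, ?_⟩
  · simp only [hA]
    unfold IsHermitian
    rw [conjTranspose_smul, hT.isHermitian.eq]
    simp
  · simp only [hA]
    rw [Matrix.smul_mul, Matrix.mul_smul, hT.isIdempotent]
  · simp only [hA]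
    change _ < (trace ((d : ℂ) • T * G d)).re + _
    have h7 : (trace ((d : ℂ) • T * G d)).re =
        d * d * (trace (T * ((d : ℂ)⁻¹ • G d))).re := by
      rw [← Nat.cast_mul, ← Complex.re_ofReal_mul, Matrix.mul_smul, Matrix.smul_mul, trace_smul,
        trace_smul, smul_eq_mul, smul_eq_mul]
      push_cast
      congr 1
      field_simp
    have h8 : (trace ((d : ℂ) • T)).re = d * (trace T).re := by
      rw [trace_smul, smul_eq_mul, ← Complex.ofReal_natCast, Complex.re_ofReal_mul]
    rw [h7, h8]
    have h9 : (d : ℝ) * d * (lam * (trace T).re) < d * d *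
        ((trace (T * ((d : ℂ)⁻¹ • G d))).re + N - (N * N * K : ℝ) / d) := by gcongr
    have h10 : (d : ℝ) * d * ((N * N * K : ℝ) / d) = N * N * K * d := by field_simp
    nlinarith
  · intro i j
    simp only [hA, hBd]
    change 2 * (N : ℝ) * ‖((d * d * (lam + 1) : ℂ) • (1 : Matrix (Fin N) (Fin N) ℂ) +
        ((((1 + lam) * b : ℕ) : ℂ) * d) • (d : ℂ) • T - (d : ℂ) • G d - (B d)ᴴ * B d) i j‖ ≤ _
    have h7 : (d * d * (lam + 1) : ℂ) • (1 : Matrix (Fin N) (Fin N) ℂ) +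
        ((((1 + lam) * b : ℕ) : ℂ) * d) • (d : ℂ) • T - (d : ℂ) • G d - (B d)ᴴ * B d =
        ((d : ℂ) * d) • ((lam + 1 : ℂ) •
          (1 : Matrix (Fin N) (Fin N) ℂ) + (((1 + lam) * b : ℕ) : ℂ) • T - (d : ℂ)⁻¹ • G d -
          ((d : ℂ)⁻¹ • B d)ᴴ * ((d : ℂ)⁻¹ • B d)) := by
      rw [conjTranspose_smul, Matrix.smul_mul, Matrix.mul_smul, star_inv₀,
        Complex.star_def, Complex.conj_natCast]
      match_scalars <;> field_simp
    rw [h7, Matrix.smul_apply, norm_smul, norm_mul, Complex.norm_natCast]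
    have := h5 i j
    have h8 : (0 : ℝ) < d * d := by positivity
    nlinarith
  · have : ProjCert.proj (d, LA, LB) N = T := by
      simp only [ProjCert.proj, hA]
      rw [smul_smul, inv_mul_cancel₀ hdC, one_smul]
    rw [this, hTT₀]

/-! ### Tensoring with the identity -/

theorem half_lt {n : ℕ} (r : Fin (2 ^ (n + 1))) : (r : ℕ) / 2 < 2 ^ n :=
  Nat.div_lt_of_lt_mul (by rw [← pow_succ']; exact r.2)

theorem tensorId_apply {n : ℕ} (A : QMat n) (r s : Fin (2 ^ (n + 1))) :
    tensorId A r s = if (r : ℕ) % 2 = s % 2 then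
      A ⟨r / 2, half_lt r⟩
        ⟨s / 2, half_lt s⟩ else 0 := by
  obtain ⟨⟨i, b⟩, rfl⟩ := (snocEquiv n).surjective r
  obtain ⟨⟨j, c⟩, rfl⟩ := (snocEquiv n).surjective s
  have hval : ∀ (i : Fin (2 ^ n)) (b : Fin 2), ((snocEquiv n (i, b) : Fin _) : ℕ) = b + 2 * i :=
    fun i b => by simp [snocEquiv]
  have hmod : ∀ (i : Fin (2 ^ n)) (b : Fin 2), ((b : ℕ) + 2 * i) % 2 = b := fun i b => by omega
  have hdiv : ∀ (i : Fin (2 ^ n)) (b : Fin 2), ((b : ℕ) + 2 * i) / 2 = i := fun i b => by omega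
  simp only [hval, hmod, hdiv, Fin.eta]
  simp only [tensorId, Matrix.reindex_apply, Matrix.submatrix_apply, Equiv.symm_apply_apply,
    Matrix.kroneckerMap_apply, Matrix.one_apply, Fin.ext_iff]
  split_ifs <;> simp

theorem tensorId_smul {n : ℕ} (z : ℂ) (A : QMat n) : tensorId (z • A) = z • tensorId A := by
  ext r s
  simp only [tensorId_apply, Matrix.smul_apply, smul_eq_mul, mul_ite, mul_zero]

theorem tensorId_sum {n : ℕ} (s : Finset ℕ) (A : ℕ → QMat n) :
    tensorId (∑ k ∈ s, A k) = ∑ k ∈ s, tensorId (A k) := by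
  ext r t
  simp only [Matrix.sum_apply, tensorId_apply]
  split_ifs <;> simp

theorem trace_tensorId {n : ℕ} (A : QMat n) : trace (tensorId A) = 2 * trace A := by
  have h1 : partialTrace (1 : QMat (n + 1)) = (2 : ℂ) • (1 : QMat n) := by
    ext i j
    by_cases h : i = j
    · subst h; simp [partialTrace]
    · simp [partialTrace, h]
  have h := trace_mul_tensorId (1 : QMat (n + 1)) A
  rwa [Matrix.one_mul, h1, Matrix.smul_mul, Matrix.one_mul, trace_smul, smul_eq_mul] at h

theorem IsGaussianProj.tensorId {n : ℕ} {T : QMat n} (hT : IsGaussianProj T) :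
    IsGaussianProj (tensorId T) := by
  obtain ⟨d, hd, A, hA⟩ := hT.exists_denom
  refine ⟨tensorId_isHermitian hT.isHermitian, by rw [tensorId_mul, hT.isIdempotent], d, hd,
    Matrix.of fun r s => if (r : ℕ) % 2 = s % 2 then
      A ⟨r / 2, half_lt r⟩
        ⟨s / 2, half_lt s⟩ else 0, ?_⟩
  rw [← tensorId_smul, hA]
  ext r s
  simp only [tensorId_apply, Matrix.map_apply, Matrix.of_apply]
  split_ifs <;> simp

/-! ### Operator inequalities for quantum `Σ⁰₁` sets -/

theorem QSigmaSet.posSemidef_proj (G : QSigmaSet) (n : ℕ) : (G.proj n).PosSemidef :=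
  posSemidef_of_isHermitian_of_idempotent (G.special n).isHermitian (G.special n).isIdempotent

theorem QSigmaSet.posSemidef_one_sub (G : QSigmaSet) (n : ℕ) :
    (1 - G.proj n : QMat n).PosSemidef :=
  posSemidef_of_isHermitian_of_idempotent (isHermitian_one.sub (G.special n).isHermitian)
    (by simp [Matrix.mul_sub, Matrix.sub_mul, (G.special n).isIdempotent])

theorem QSigmaSet.posSemidef_sub_tensorId (G : QSigmaSet) (n : ℕ) :
    (G.proj (n + 1) - tensorId (G.proj n)).PosSemidef := by
  have hq := G.special (n + 1)
  have hp := G.special n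
  have hP := tensorId_isHermitian hp.isHermitian
  have h1 := mul_eq_of_range_le hq.isIdempotent (G.nested n)
  have h2 : tensorId (G.proj n) * G.proj (n + 1) = tensorId (G.proj n) := by
    have := congrArg Matrix.conjTranspose h1
    rwa [Matrix.conjTranspose_mul, hP.eq, hq.isHermitian.eq] at this
  refine posSemidef_of_isHermitian_of_idempotent (hq.isHermitian.sub hP) ?_
  rw [Matrix.mul_sub, Matrix.sub_mul, Matrix.sub_mul, h1, h2, hq.isIdempotent, tensorId_mul,
    hp.isIdempotent]
  simp

/-! ### Codes of Gaussian rational numbers -/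

/-- A code of `z / d`. -/
def gaussianCode (z : GaussianInt) (d : ℕ) : AlgCode :=
  ([z.re * z.re + z.im * z.im, -(2 * (d : ℤ) * z.re), (d : ℤ) * d], (z.re, z.im), d - 1)

/-- The polynomial is `(d X - z) (d X - z̄)`. Its other root is at distance `2 |im z| / d` from `z /
d`, hence outside the disc of radius `1 / d` unless `im z = 0`, when the two roots coincide. -/
theorem gaussianCode_represents (z : GaussianInt) {d : ℕ} (hd : 0 < d) :
    (gaussianCode z d).Represents (GaussianInt.toComplex z / d) := by
  have hdC : (d : ℂ) ≠ 0 := by exact_mod_cast hd.ne'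
  have hdR : (0 : ℝ) < d := by exact_mod_cast hd
  have haeval : ∀ w : ℂ, Polynomial.aeval w (polyOfList (gaussianCode z d).1) =
      (d * w - (z.re + z.im * Complex.I)) * (d * w - (z.re - z.im * Complex.I)) := by
    intro w
    simp only [gaussianCode, polyOfList, map_add, map_mul, Polynomial.aeval_X,
      mul_zero, add_zero, map_neg, map_natCast, map_ofNat, eq_intCast, map_intCast]
    linear_combination (z.im : ℂ) ^ 2 * Complex.I_sq
  have hdisc : ∀ w, w ∈ (gaussianCode z d).disc ↔
      ‖w - (z.re + z.im * Complex.I) / d‖ ≤ 1 / d := by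
    intro w
    have h1 : (((d - 1 : ℕ) : ℂ) + 1) = d := by exact_mod_cast Nat.sub_add_cancel hd
    have h2 : (((d - 1 : ℕ) : ℝ) + 1) = d := by exact_mod_cast Nat.sub_add_cancel hd
    rw [AlgCode.disc, mem_closedBall_iff_norm]
    simp only [gaussianCode, h1, h2]
  rw [GaussianInt.toComplex_def]
  refine ⟨fun h0 => ?_, ?_, ?_, fun w hw hw0 => ?_⟩
  -- At `(re z + 1) / d` the polynomial takes the value `1 + (im z) ²`, so it is not zero.
  · have h1 := haeval ((z.re + 1) / d)
    rw [h0, map_zero, mul_div_cancel₀ _ hdC] at h1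
    have h2 : (z.im : ℂ) ^ 2 + 1 = 0 := by linear_combination -h1 + (z.im : ℂ) ^ 2 * Complex.I_sq
    have h3 : z.im ^ 2 + 1 = 0 := by exact_mod_cast h2
    nlinarith [sq_nonneg z.im]
  · rw [haeval, mul_div_cancel₀ _ hdC, sub_self, zero_mul]
  · rw [hdisc, sub_self, norm_zero]; positivity
  · rw [haeval] at hw0
    rcases mul_eq_zero.1 hw0 with h | h
    · rw [eq_div_iff hdC]; linear_combination h
    · rw [hdisc] at hw
      have hw' : w = (z.re - z.im * Complex.I) / d := by
        rw [eq_div_iff hdC]; linear_combination h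
      have h1 : w - (z.re + z.im * Complex.I) / d = ((-2 * z.im : ℤ) : ℂ) * Complex.I / d := by
        rw [hw']; push_cast; ring
      rw [h1, norm_div, norm_mul, Complex.norm_I, mul_one, Complex.norm_intCast,
        Complex.norm_natCast, div_le_div_iff_of_pos_right hdR] at hw
      have h2 : |-2 * z.im| ≤ 1 := by exact_mod_cast hw
      have h3 : z.im = 0 := by rw [abs_le] at h2; omega
      rw [hw', h3]; simp

/-- A code of the projection of `W`, of size `N`. -/
def ProjCert.code (W : ProjCert) (N : ℕ) : MatrixCode :=
  (List.range N).map fun i => (List.range N).map fun j => gaussianCode (listEntry W.2.1 i j) W.1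

theorem ProjCert.code_represents {W : ProjCert} (hd : 0 < W.1) (N : ℕ) :
    (W.code N).Represents (W.proj N) := by
  refine ⟨by simp [ProjCert.code], fun row hrow => ?_, fun i j => ?_⟩
  · simp only [ProjCert.code, List.mem_map] at hrow
    obtain ⟨i, -, rfl⟩ := hrow
    simp
  · refine ⟨_, by simp only [ProjCert.code, List.getElem?_map, List.getElem?_range i.2]; rfl,
      _, by simp only [List.getElem?_map, List.getElem?_range j.2]; rfl, ?_⟩
    have : W.proj N i j = GaussianInt.toComplex (listEntry W.2.1 i j) / W.1 := by
      simp only [ProjCert.proj, listMatrix, Matrix.smul_apply, Matrix.of_apply, smul_eq_mul]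
      rw [inv_mul_eq_div]
    rw [this]
    exact gaussianCode_represents _ hd

theorem AlgCode.Represents.isAlgebraic {c : AlgCode} {z : ℂ} (h : c.Represents z) :
    IsAlgebraic ℚ z := by
  have : IsAlgebraic ℤ z := ⟨_, h.1, h.2.1⟩
  exact (IsFractionRing.isAlgebraic_iff ℤ ℚ ℂ).1 this

/-! ### Decidability of validity and computability of the matrix codes -/

section

variable {α : Type*} [Primcodable α]

theorem computable_map_range {β : Type*} [Primcodable β] {n : α → ℕ} {f : α → ℕ → β}
    (hn : Computable n) (hf : Computable fun p : α × ℕ => f p.1 p.2) :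
    Computable fun a => (List.range (n a)).map (f a) := by
  have h : Computable fun a => (Nat.rec [] (fun i l => l ++ [f a i]) (n a) : List β) :=
    Computable.nat_rec hn (Computable.const [])
      (Computable.list_concat.comp (Computable.snd.comp Computable.snd)
        (hf.comp (Computable.fst.pair (Computable.fst.comp Computable.snd)))).to₂
  refine h.of_eq fun a => ?_
  induction n a with
  | zero => simp
  | succ k ih => simp only [ih, List.range_succ, List.map_append, List.map_cons, List.map_nil]

theorem computable_gaussianCode {z : α → GaussianInt} {d : α → ℕ} (hz : Computable z)
    (hd : Computable d) : Computable fun a => gaussianCode (z a) (d a) := by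
  have hre := hz.gaussian_re
  have him := hz.gaussian_im
  have hdz := hd.int_natCast
  refine Computable.pair ?_ ((hre.pair him).pair (Computable.pred.comp hd))
  exact Computable.list_cons.comp ((hre.int_mul hre).int_add (him.int_mul him))
    (Computable.list_cons.comp (((Computable.const 2).int_mul hdz).int_mul hre).int_neg
      (Computable.list_cons.comp (hdz.int_mul hdz) (Computable.const [])))

theorem computable_listEntry {L : α → List GaussianInt} {i j : α → ℕ} (hL : Computable L)
    (hi : Computable i) (hj : Computable j) :
    Computable fun a => listEntry (L a) (i a) (j a) :=
  Computable.list_getD 0 hL (hi.natPair hj)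

theorem computable_code {W : α → ProjCert} {N : α → ℕ} (hW : Computable W) (hN : Computable N) :
    Computable fun a => (W a).code (N a) := by
  refine computable_map_range hN (computable_map_range (hN.comp Computable.fst) ?_)
  have hW' := hW.comp ((Computable.fst (α := α) (β := ℕ)).comp
    (Computable.fst (α := α × ℕ) (β := ℕ)))
  exact computable_gaussianCode (computable_listEntry (Computable.fst.comp
    (Computable.snd.comp hW')) (Computable.snd.comp Computable.fst) Computable.snd)
    (Computable.fst.comp hW')

theorem computablePred_valid {h : α → ℕ → ℕ → ℕ → GaussianInt} {N K lam c : α → ℕ}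
    {W : α → ProjCert} (hh : Computable fun p : α × ℕ × ℕ × ℕ => h p.1 p.2.1 p.2.2.1 p.2.2.2)
    (hN : Computable N) (hK : Computable K) (hlam : Computable lam) (hc : Computable c)
    (hW : Computable W) :
    ComputablePred fun a => (W a).Valid (h a) (N a) (K a) (lam a) (c a) := by
  have hd := Computable.fst.comp hW
  have hA := Computable.fst.comp (Computable.snd.comp hW)
  have hB := Computable.snd.comp (Computable.snd.comp hW)
  have a2 : Computable fun p : (α × ℕ) × ℕ => p.1.1 := Computable.fst.comp Computable.fst
  have i2 : Computable fun p : (α × ℕ) × ℕ => p.1.2 := Computable.snd.comp Computable.fst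
  have j2 : Computable fun p : (α × ℕ) × ℕ => p.2 := Computable.snd
  have a3 : Computable fun p : ((α × ℕ) × ℕ) × ℕ => p.1.1.1 := a2.comp Computable.fst
  have i3 : Computable fun p : ((α × ℕ) × ℕ) × ℕ => p.1.1.2 := i2.comp Computable.fst
  have j3 : Computable fun p : ((α × ℕ) × ℕ) × ℕ => p.1.2 := j2.comp Computable.fst
  have k3 : Computable fun p : ((α × ℕ) × ℕ) × ℕ => p.2 := Computable.snd
  have hd2 := hd.comp a2
  have hA2 := hA.comp a2
  have hN1 : Computable fun p : α × ℕ => N p.1 := hN.comp Computable.fst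
  have hij := computable_listEntry hA2 i2 j2
  have hhij := hh.comp (a2.pair (i2.pair (j2.pair hd2)))
  have hhji := hh.comp (a2.pair (j2.pair (i2.pair hd2)))
  refine ((Computable.const 0).nat_lt_pred hd).and (ComputablePred.and ?_ (ComputablePred.and ?_
    (ComputablePred.and ?_ (ComputablePred.and ?_ ?_))))
  · exact .forall_lt hN (.forall_lt hN1 (hij.gaussian_star.eq_pred
      (computable_listEntry hA2 j2 i2)))
  · refine .forall_lt hN (.forall_lt hN1 (Computable.eq_pred ?_
      (hd2.gaussian_natCast.gaussian_mul hij)))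
    exact Computable.gaussian_sum (hN.comp a2)
      ((computable_listEntry (hA.comp a3) i3 k3).gaussian_mul
        (computable_listEntry (hA.comp a3) k3 j3))
  · have e1 := (hlam.nat_mul hd).gaussian_natCast.gaussian_mul (Computable.gaussian_sum
      (f := fun a i => listEntry (W a).2.1 i i) hN
      (computable_listEntry (hA.comp Computable.fst) Computable.snd Computable.snd))
    have e2 := Computable.gaussian_sum (f := fun a i => ∑ j ∈ Finset.range (N a),
      listEntry (W a).2.1 i j * h a j i (W a).1) hN
      (Computable.gaussian_sum (f := fun (p : α × ℕ) j => listEntry (W p.1).2.1 p.2 j *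
        h p.1 j p.2 (W p.1).1) hN1 (hij.gaussian_mul hhji))
    exact (e1.gaussian_re.int_add
      (((hN.nat_mul hN).nat_mul hK).nat_mul hd).int_natCast).int_lt_pred
      (e2.gaussian_re.int_add ((hN.nat_mul hd).nat_mul hd).int_natCast)
  · have e1 := (((hd2.nat_mul hd2).nat_mul (Computable.succ.comp (hlam.comp a2))).nat_mul
        (Computable.ite (i2.eq_pred j2) (Computable.const 1)
          (Computable.const 0))).gaussian_natCast
    have e2 := ((hc.comp a2).nat_mul hd2).gaussian_natCast.gaussian_mul hij
    have e3 := hd2.gaussian_natCast.gaussian_mul hhij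
    have e4 := Computable.gaussian_sum (f := fun (p : (α × ℕ) × ℕ) k =>
      star (listEntry (W p.1.1).2.2 k p.1.2) * listEntry (W p.1.1).2.2 k p.2) (hN.comp a2)
      ((computable_listEntry (hB.comp a3) k3 i3).gaussian_star.gaussian_mul
        (computable_listEntry (hB.comp a3) k3 j3))
    have e5 := (((e1.gaussian_add e2).gaussian_sub e3).gaussian_sub e4).gaussian_norm_natAbs
    exact .forall_lt hN (.forall_lt hN1
      (((((Computable.const 2).nat_mul (hN.comp a2)).nat_pow (Computable.const 2)).nat_mul
        e5).nat_le_pred ((hd2.nat_mul hd2).nat_pow (Computable.const 2))))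
  · exact (((Computable.const 2).nat_mul hN).nat_mul hK).nat_le_pred hd

end

/-! ### Nested certificates -/

/-- The entries of `A ⊗ I`. -/
def listEntryTensor (L : List GaussianInt) (r s : ℕ) : GaussianInt :=
  if r % 2 = s % 2 then listEntry L (r / 2) (s / 2) else 0

/-- The projection of `W'` is at least that of `W`, tensored with the identity. -/
def ProjCert.Nested (t : ℕ) (W W' : ProjCert) : Prop :=
  ∀ r < 2 ^ (t + 1), ∀ s < 2 ^ (t + 1),
    ∑ k ∈ Finset.range (2 ^ (t + 1)), listEntry W'.2.1 r k * listEntryTensor W.2.1 k s =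
      (W'.1 : GaussianInt) * listEntryTensor W.2.1 r s

theorem ProjCert.nested_iff {t : ℕ} {W W' : ProjCert} (hd : 0 < W.1) (hd' : 0 < W'.1) :
    ProjCert.Nested t W W' ↔
      W'.proj (2 ^ (t + 1)) * tensorId (W.proj (2 ^ t)) = tensorId (W.proj (2 ^ t)) := by
  have hdC : (W.1 : ℂ) ≠ 0 := by exact_mod_cast hd.ne'
  have hdC' : (W'.1 : ℂ) ≠ 0 := by exact_mod_cast hd'.ne'
  have htens : ∀ r s : Fin (2 ^ (t + 1)), GaussianInt.toComplex (listEntryTensor W.2.1 r s) =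
      tensorId (n := t) (listMatrix (2 ^ t) W.2.1) r s := by
    intro r s
    rw [tensorId_apply, listEntryTensor]
    split_ifs <;> simp [listMatrix]
  have h1 : ProjCert.Nested t W W' ↔
      listMatrix (2 ^ (t + 1)) W'.2.1 * tensorId (n := t) (listMatrix (2 ^ t) W.2.1) =
        (W'.1 : ℂ) • tensorId (n := t) (listMatrix (2 ^ t) W.2.1) := by
    unfold ProjCert.Nested
    rw [forall_lt_iff_fin, ← Matrix.ext_iff]
    refine forall₂_congr fun i j => ?_
    rw [← GaussianInt.toComplex_inj, map_sum, map_mul, map_natCast, Finset.sum_range,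
      Matrix.mul_apply, Matrix.smul_apply, smul_eq_mul, htens]
    simp only [map_mul, htens]
    rfl
  rw [h1, ProjCert.proj, ProjCert.proj, tensorId_smul, Matrix.smul_mul, Matrix.mul_smul,
    smul_comm]
  constructor
  · intro h
    rw [h, smul_smul, smul_smul, mul_assoc, inv_mul_cancel₀ hdC', mul_one]
  · intro h
    have := smul_right_injective _ (inv_ne_zero hdC) h
    conv_rhs => rw [← this, smul_smul, mul_inv_cancel₀ hdC', one_smul]

theorem computablePred_nested {α : Type*} [Primcodable α] {t : α → ℕ} {W W' : α → ProjCert}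
    (ht : Computable t) (hW : Computable W) (hW' : Computable W') :
    ComputablePred fun a => ProjCert.Nested (t a) (W a) (W' a) := by
  have hN : Computable fun a => 2 ^ (t a + 1) :=
    (Computable.const 2).nat_pow (Computable.succ.comp ht)
  have tens : ∀ {β : Type _} [Primcodable β] {L : β → List GaussianInt} {r s : β → ℕ},
      Computable L → Computable r → Computable s →
      Computable fun b => listEntryTensor (L b) (r b) (s b) := by
    intro β _ L r s hL hr hs
    have h2 : Computable fun _ : β => 2 := Computable.const 2
    exact Computable.ite ((hr.nat_mod h2).eq_pred (hs.nat_mod h2))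
      (computable_listEntry hL (hr.nat_div h2) (hs.nat_div h2)) (Computable.const 0)
  have a2 : Computable fun p : (α × ℕ) × ℕ => p.1.1 := Computable.fst.comp Computable.fst
  have i2 : Computable fun p : (α × ℕ) × ℕ => p.1.2 := Computable.snd.comp Computable.fst
  have j2 : Computable fun p : (α × ℕ) × ℕ => p.2 := Computable.snd
  have a3 : Computable fun p : ((α × ℕ) × ℕ) × ℕ => p.1.1.1 := a2.comp Computable.fst
  have i3 : Computable fun p : ((α × ℕ) × ℕ) × ℕ => p.1.1.2 := i2.comp Computable.fst
  have j3 : Computable fun p : ((α × ℕ) × ℕ) × ℕ => p.1.2 := j2.comp Computable.fst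
  have k3 : Computable fun p : ((α × ℕ) × ℕ) × ℕ => p.2 := Computable.snd
  have hA := Computable.fst.comp (Computable.snd.comp hW)
  have hA' := Computable.fst.comp (Computable.snd.comp hW')
  refine .forall_lt hN (.forall_lt (hN.comp Computable.fst) (Computable.eq_pred
    (Computable.gaussian_sum (hN.comp a2) ?_) ?_))
  · exact (computable_listEntry (hA'.comp a3) i3 k3).gaussian_mul (tens (hA.comp a3) k3 j3)
  · exact ((Computable.fst.comp hW').comp a2).gaussian_natCast.gaussian_mul
      (tens (hA.comp a2) i2 j2)

/-! ### From a quantum Solovay test to a quantum Martin-Löf test -/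

theorem IsComputableSeq.exists_approx {S : ℕ → QSigmaSet} (hS : IsComputableSeq S) :
    ∃ g : ℕ × ℕ × ℕ × ℕ × ℕ → GaussianInt, Computable g ∧
      ∀ k t d : ℕ, 0 < d → ∀ i j : Fin (2 ^ t),
        ‖(d : ℂ) * (S k).proj t i j - GaussianInt.toComplex (g (k, t, i, j, d))‖ ≤ 4 := by
  obtain ⟨f, hf, hrep⟩ := hS
  let code : ℕ × ℕ × ℕ × ℕ × ℕ → AlgCode := fun a =>
    ((f (a.1, a.2.1)).getD a.2.2.1 []).getD a.2.2.2.1 ([], (0, 0), 0)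
  have x2 : Computable fun a : ℕ × ℕ × ℕ × ℕ × ℕ => a.2.1 := Computable.fst.comp Computable.snd
  have x3 : Computable fun a : ℕ × ℕ × ℕ × ℕ × ℕ => a.2.2.1 :=
    Computable.fst.comp (Computable.snd.comp Computable.snd)
  have x4 : Computable fun a : ℕ × ℕ × ℕ × ℕ × ℕ => a.2.2.2.1 :=
    Computable.fst.comp (Computable.snd.comp (Computable.snd.comp Computable.snd))
  have x5 : Computable fun a : ℕ × ℕ × ℕ × ℕ × ℕ => a.2.2.2.2 :=
    Computable.snd.comp (Computable.snd.comp (Computable.snd.comp Computable.snd))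
  have hcode : Computable code :=
    Computable.list_getD _ (Computable.list_getD _ (hf.comp (Computable.fst.pair x2)) x3) x4
  have hcode_rep : ∀ k t d : ℕ, ∀ i j : Fin (2 ^ t),
      (code (k, t, i, j, d)).Represents ((S k).proj t i j) := by
    intro k t d i j
    obtain ⟨-, -, h⟩ := hrep k t
    obtain ⟨row, hrow, a, ha, har⟩ := h i j
    simpa [code, List.getD_eq_getElem?_getD, hrow, ha] using har
  -- The premise makes the relation vacuous for `d = 0` and for indices outside the matrix, where a
  -- certificate may not exist; the search must succeed on every input.
  let R : ℕ × ℕ × ℕ × ℕ × ℕ → GaussianInt × ℕ → Prop := fun a b =>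
    (0 < a.2.2.2.2 ∧ a.2.2.1 < 2 ^ a.2.1 ∧ a.2.2.2.1 < 2 ^ a.2.1) →
      (code a).Cert a.2.2.2.2 b.1 b.2
  have hdec : ComputablePred fun p : (ℕ × ℕ × ℕ × ℕ × ℕ) × GaussianInt × ℕ => R p.1 p.2 := by
    have hpow := (Computable.const 2).nat_pow (x2.comp (Computable.fst (β := GaussianInt × ℕ)))
    refine (((Computable.const 0).nat_lt_pred (x5.comp Computable.fst)).and
      (((x3.comp Computable.fst).nat_lt_pred hpow).and
        ((x4.comp Computable.fst).nat_lt_pred hpow))).imp ?_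
    exact computablePred_cert (hcode.comp Computable.fst) (x5.comp Computable.fst)
      (Computable.fst.comp Computable.snd) (Computable.snd.comp Computable.snd)
  obtain ⟨φ, hφ, hφ'⟩ := exists_computable_choice (R := R) hdec (by
    rintro ⟨k, t, i, j, d⟩
    by_cases h : 0 < d ∧ i < 2 ^ t ∧ j < 2 ^ t
    · obtain ⟨q, n, hq⟩ := AlgCode.exists_cert (hcode_rep k t d ⟨i, h.2.1⟩ ⟨j, h.2.2⟩) h.1
      exact ⟨(q, n), fun _ => hq⟩
    · exact ⟨(0, 0), fun h' => absurd h' h⟩)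
  exact ⟨fun a => (φ a).1, Computable.fst.comp hφ, fun k t d hd i j =>
    AlgCode.Cert.norm_le (hcode_rep k t d i j) hd (hφ' (k, t, i, j, d) ⟨hd, i.2, j.2⟩)⟩

/-- The sum of the projections of the first `t + 1` sets at stage `t`. -/
def partialSum (S : ℕ → QSigmaSet) (t : ℕ) : QMat t :=
  ∑ k ∈ Finset.range (t + 1), (S k).proj t

theorem IsComputableSeq.exists_approx_partialSum {S : ℕ → QSigmaSet} (hS : IsComputableSeq S) :
    ∃ h : ℕ × ℕ × ℕ × ℕ → GaussianInt, Computable h ∧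
      ∀ t d : ℕ, 0 < d → ∀ i j : Fin (2 ^ t),
        ‖(d : ℂ) * partialSum S t i j - GaussianInt.toComplex (h (t, i, j, d))‖ ≤
          (4 * (t + 1) : ℕ) := by
  obtain ⟨g, hg, hg'⟩ := hS.exists_approx
  refine ⟨fun a => ∑ k ∈ Finset.range (a.1 + 1), g (k, a), ?_, fun t d hd i j => ?_⟩
  · exact Computable.gaussian_sum (f := fun (a : ℕ × ℕ × ℕ × ℕ) k => g (k, a))
      (Computable.succ.comp Computable.fst) (hg.comp (Computable.snd.pair Computable.fst))
  · rw [partialSum, Matrix.sum_apply, Finset.mul_sum, map_sum, ← Finset.sum_sub_distrib]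
    refine (norm_sum_le_of_le _ fun k _ => hg' k t d hd i j).trans (le_of_eq ?_)
    simp
    ring

theorem posSemidef_sum_proj (S : ℕ → QSigmaSet) (s : Finset ℕ) (t : ℕ) :
    (∑ k ∈ s, (S k).proj t).PosSemidef :=
  posSemidef_sum s fun k _ => (S k).posSemidef_proj t

theorem posSemidef_card_sub_sum_proj (S : ℕ → QSigmaSet) (s : Finset ℕ) (t : ℕ) :
    ((s.card : ℂ) • (1 : QMat t) - ∑ k ∈ s, (S k).proj t).PosSemidef := by
  have h := posSemidef_sum s fun k _ => (S k).posSemidef_one_sub t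
  rwa [Finset.sum_sub_distrib, Finset.sum_const, ← Nat.cast_smul_eq_nsmul ℂ] at h

/-- Both changes from stage `t` to `t + 1` increase the sum: each old projection dominates its
predecessor tensored with the identity, and one more projection is added. -/
theorem posSemidef_partialSum_succ_sub (S : ℕ → QSigmaSet) (t : ℕ) :
    (partialSum S (t + 1) - tensorId (partialSum S t)).PosSemidef := by
  have h := (posSemidef_sum (Finset.range (t + 1)) fun k _ =>
    (S k).posSemidef_sub_tensorId t).add ((S (t + 1)).posSemidef_proj (t + 1))
  rw [Finset.sum_sub_distrib, ← tensorId_sum] at h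
  convert h using 1
  rw [partialSum, partialSum, Finset.sum_range_succ]
  abel

theorem IsGaussianProj.posSemidef {n : Type*} [Fintype n] [DecidableEq n] {T : Matrix n n ℂ}
    (hT : IsGaussianProj T) : T.PosSemidef :=
  posSemidef_of_isHermitian_of_idempotent hT.isHermitian hT.isIdempotent

theorem IsGaussianProj.zero {n : Type*} [Fintype n] [DecidableEq n] :
    IsGaussianProj (0 : Matrix n n ℂ) :=
  ⟨isHermitian_zero, by simp, 1, one_pos, 0, by ext; simp⟩

/-- The step of the construction: an almost `lam`-large projection at stage `t` is below one at
stage `t + 1`. -/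
theorem lt_trace_tensorId_mul {S : ℕ → QSigmaSet} {t : ℕ} {T : QMat t} (hT : IsGaussianProj T)
    {lam : ℝ} (h : lam * (trace T).re < (trace (T * partialSum S t)).re + (2 ^ t : ℕ)) :
    lam * (trace (tensorId T)).re <
      (trace (tensorId T * partialSum S (t + 1))).re + (2 ^ (t + 1) : ℕ) := by
  -- Tensoring doubles both traces, which is why the slack is `2 ^ t`; the growth of the partial sum
  -- only helps.
  have h1 := hT.tensorId.posSemidef.trace_mul_le (posSemidef_partialSum_succ_sub S t)
  rw [tensorId_mul, trace_tensorId] at h1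
  rw [trace_tensorId]
  have h2 : ∀ z : ℂ, (2 * z).re = 2 * z.re := fun z => by simp
  rw [h2] at *
  push_cast at *
  have h3 : (2 : ℝ) ^ (t + 1) = 2 ^ t * 2 := pow_succ _ _
  nlinarith

/-- A uniformly computable sequence of projections that capture all directions in which many of
the sets `S k` are large. -/
theorem IsComputableSeq.exists_dominating {S : ℕ → QSigmaSet} (hS : IsComputableSeq S)
    {lam : ℕ → ℕ} (hlam : Computable lam) (hlam0 : ∀ m, 0 < lam m) :
    ∃ T : ℕ → QSigmaSet, IsComputableSeq T ∧ ∀ m t,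
      (lam m : ℝ) * (trace ((T m).proj t)).re <
        (trace ((T m).proj t * partialSum S t)).re + (2 ^ t : ℕ) ∧
      ∃ c : ℝ, ∃ P : QMat t, P.PosSemidef ∧ ∀ i j,
        ‖((lam m + 1 : ℂ) • (1 : QMat t) + (c : ℂ) • (T m).proj t - partialSum S t - P) i j‖ ≤
          1 / (2 ^ t : ℕ) := by
  obtain ⟨h, hh, happrox⟩ := hS.exists_approx_partialSum
  -- The accuracy `4 * (t + 1)` is that of a sum of `t + 1` approximations; the coefficient of `T`
  -- comes from the domination with `partialSum S t ≤ t + 1`.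
  let V : ℕ → ℕ → ProjCert → Prop := fun m t W =>
    W.Valid (fun i j d => h (t, i, j, d)) (2 ^ t) (4 * (t + 1)) (lam m) ((1 + lam m) * (t + 1))
  have hVcomp : ∀ {α : Type} [Primcodable α] {m t : α → ℕ} {W : α → ProjCert}, Computable m →
      Computable t → Computable W → ComputablePred fun a => V (m a) (t a) (W a) := by
    intro α _ m t W hm ht hW
    have ht1 : Computable fun a => t a + 1 := Computable.succ.comp ht
    have hl : Computable fun a => lam (m a) := hlam.comp hm
    exact computablePred_valid (h := fun a i j d => h (t a, i, j, d))
      (hh.comp ((ht.comp Computable.fst).pair Computable.snd))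
      ((Computable.const 2).nat_pow ht) ((Computable.const 4).nat_mul ht1) hl
      (((Computable.const 1).nat_add hl).nat_mul ht1) hW
  have hsound := fun m t W (hW : V m t W) =>
    hW.sound (by positivity : 0 < 2 ^ t) (H := partialSum S t) fun d hd => happrox t d hd
  have hexists : ∀ m t, ∀ T₀ : QMat t, IsGaussianProj T₀ →
      (lam m : ℝ) * (trace T₀).re < (trace (T₀ * partialSum S t)).re + (2 ^ t : ℕ) →
      ∃ W : ProjCert, V m t W ∧ W.proj (2 ^ t) * T₀ = T₀ := by
    intro m t T₀ hT₀ htr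
    have hcard := posSemidef_card_sub_sum_proj S (Finset.range (t + 1)) t
    rw [Finset.card_range] at hcard
    exact ProjCert.exists_valid (h := fun i j d => h (t, i, j, d)) (N := 2 ^ t)
      (K := 4 * (t + 1)) (b := t + 1) (H := partialSum S t) (hlam0 m) (by positivity)
      (posSemidef_sum_proj S _ t) hcard (happrox t) hT₀ htr
  obtain ⟨W₀, hW₀, hW₀V⟩ := exists_computable_choice (R := fun m W => V m 0 W)
    (hVcomp Computable.fst (Computable.const 0) Computable.snd) fun m => by
      -- The zero projection satisfies the strict invariant thanks to the slack `2 ^ 0`.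
      obtain ⟨W, hW, -⟩ := hexists m 0 0 IsGaussianProj.zero (by simp)
      exact ⟨W, hW⟩
  -- Validity of the old certificate is a premise, so that the search is total; along the recursion
  -- below the premise always holds.
  obtain ⟨step, hstep, hstepV⟩ := exists_computable_choice
    (R := fun (a : ℕ × ℕ × ProjCert) W' => V a.1 a.2.1 a.2.2 →
      V a.1 (a.2.1 + 1) W' ∧ ProjCert.Nested a.2.1 a.2.2 W') (by
        have y1 : Computable fun p : (ℕ × ℕ × ProjCert) × ProjCert => p.1.1 :=
          Computable.fst.comp Computable.fst
        have y2 : Computable fun p : (ℕ × ℕ × ProjCert) × ProjCert => p.1.2.1 :=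
          Computable.fst.comp (Computable.snd.comp Computable.fst)
        have y3 : Computable fun p : (ℕ × ℕ × ProjCert) × ProjCert => p.1.2.2 :=
          Computable.snd.comp (Computable.snd.comp Computable.fst)
        exact (hVcomp y1 y2 y3).imp ((hVcomp y1 (Computable.succ.comp y2) Computable.snd).and
          (computablePred_nested y2 y3 Computable.snd))) (by
    rintro ⟨m, t, W⟩
    by_cases hW : V m t W
    · obtain ⟨h1, h2, -⟩ := hsound m t W hW
      obtain ⟨W', hW', hWW'⟩ := hexists m (t + 1) _ (IsGaussianProj.tensorId (n := t) h1)
        (lt_trace_tensorId_mul h1 h2)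
      exact ⟨W', fun _ => ⟨hW', (ProjCert.nested_iff hW.1 hW'.1).2 hWW'⟩⟩
    · exact ⟨(0, [], []), fun h' => absurd h' hW⟩)
  let W : ℕ → ℕ → ProjCert := fun m t => Nat.rec (W₀ m) (fun t w => step (m, t, w)) t
  have hWcomp : Computable fun a : ℕ × ℕ => W a.1 a.2 :=
    Computable.nat_rec Computable.snd (hW₀.comp Computable.fst)
      (hstep.comp ((Computable.fst.comp Computable.fst).pair Computable.snd)).to₂
  have hWV : ∀ m t, V m t (W m t) := fun m t => by
    induction t with
    | zero => exact hW₀V m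
    | succ t ih => exact (hstepV (m, t, W m t) ih).1
  have hWN : ∀ m t, ProjCert.Nested t (W m t) (W m (t + 1)) := fun m t =>
    (hstepV (m, t, W m t) (hWV m t)).2
  have hcode : Computable fun a : ℕ × ℕ => (W a.1 a.2).code (2 ^ a.2) :=
    computable_code hWcomp ((Computable.const 2).nat_pow Computable.snd)
  have hrep : ∀ m t, MatrixCode.Represents ((W m t).code (2 ^ t)) ((W m t).proj (2 ^ t)) :=
    fun m t => ProjCert.code_represents (hWV m t).1 _
  refine ⟨fun m =>
    { proj := fun t => (W m t).proj (2 ^ t)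
      special := fun t => ⟨(hsound m t _ (hWV m t)).1.isHermitian,
        (hsound m t _ (hWV m t)).1.isIdempotent, fun i j => by
          obtain ⟨row, -, a, -, ha⟩ := (hrep m t).2.2 i j
          exact ha.isAlgebraic⟩
      nested := fun t => by
        have h1 := (ProjCert.nested_iff (hWV m t).1 (hWV m (t + 1)).1).1 (hWN m t)
        rintro _ ⟨x, rfl⟩
        refine ⟨tensorId (n := t) ((W m t).proj (2 ^ t)) *ᵥ x, ?_⟩
        simp only [Matrix.mulVecLin_apply, Matrix.mulVec_mulVec, h1]
      computable := ⟨_, hcode.comp ((Computable.const m).pair Computable.id), fun t => hrep m t⟩ },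
    ⟨_, hcode, hrep⟩, fun m t => ?_⟩
  obtain ⟨-, h2, P, hP, hE⟩ := hsound m t _ (hWV m t)
  exact ⟨h2, (((1 + lam m) * (t + 1) : ℕ) : ℝ), P, hP, by simpa using hE⟩

/-! ### Values of states and the two implications -/

theorem State.trace_le_value (ρ : State) (G : QSigmaSet) (n : ℕ) :
    (trace (ρ.mat n * G.proj n)).re ≤ ρ.value G :=
  (ρ.trace_mono G).ge_of_tendsto
    ((Complex.continuous_re.tendsto _).comp (ρ.tendsto_value G)) n

theorem State.value_le (ρ : State) (G : QSigmaSet) {x : ℝ}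
    (h : ∀ n, (trace (ρ.mat n * G.proj n)).re ≤ x) : ρ.value G ≤ x :=
  le_of_tendsto' ((Complex.continuous_re.tendsto _).comp (ρ.tendsto_value G)) h

theorem tracialState_trace_re {n : ℕ} (A : QMat n) :
    (trace (tracialState.mat n * A)).re = ((2 : ℝ) ^ n)⁻¹ * (trace A).re := by
  have h : ((2 : ℂ) ^ n)⁻¹ = ((((2 : ℝ) ^ n)⁻¹ : ℝ) : ℂ) := by push_cast; rfl
  simp only [tracialState]
  rw [Matrix.smul_mul, Matrix.one_mul, trace_smul, smul_eq_mul, h, Complex.re_ofReal_mul]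

theorem trace_partialSum_le {S : ℕ → QSigmaSet}
    (hS : Summable fun k => tracialState.value (S k)) (t : ℕ) :
    (trace (partialSum S t)).re ≤ 2 ^ t * ∑' k, tracialState.value (S k) := by
  have h1 : (trace (tracialState.mat t * partialSum S t)).re ≤
      ∑' k, tracialState.value (S k) := by
    rw [partialSum, Matrix.mul_sum, trace_sum, Complex.re_sum]
    exact (Finset.sum_le_sum fun k _ => tracialState.trace_le_value (S k) t).trans
      (hS.sum_le_tsum _ fun k _ => (tracialState.value_mem_Icc (S k)).1)
  rwa [tracialState_trace_re, inv_mul_le_iff₀ (by positivity)] at h1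

theorem State.IsQMLRandom.isQSolovayRandom {ρ : State} (hρ : ρ.IsQMLRandom) :
    ρ.IsQSolovayRandom := by
  intro S hS δ hδ hfail
  -- One natural number above the sum suffices for all `m`, so `lam` is computable even though the
  -- sum itself need not be.
  obtain ⟨C, hC⟩ := exists_nat_ge (∑' k, tracialState.value (S k))
  obtain ⟨T, hTcomp, hT⟩ := hS.computable.exists_dominating (lam := fun m => (C + 1) * 2 ^ m)
    ((Computable.const (C + 1)).nat_mul ((Computable.const 2).nat_pow Computable.id))
    (fun m => by positivity)
  have htest : IsQMLTest T := by
    refine ⟨hTcomp, fun m => tracialState.value_le _ fun t => ?_⟩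
    have h1 := (hT m t).1
    have h2 := (posSemidef_sum_proj S (Finset.range (t + 1)) t).trace_mul_le
      ((T m).posSemidef_one_sub t)
    rw [Matrix.mul_one, trace_mul_comm] at h2
    change _ ≤ (trace (partialSum S t)).re at h2
    change _ < (trace (_ * ∑ k ∈ Finset.range (t + 1), (S k).proj t)).re + _ at h1
    have h3 := trace_partialSum_le hS.summable t
    push_cast at h1
    have h4 : (2 : ℝ) ^ t * ∑' k, tracialState.value (S k) ≤ 2 ^ t * C := by gcongr
    rw [tracialState_trace_re, inv_pow, inv_mul_le_iff₀ (by positivity), ← div_eq_mul_inv,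
      le_div_iff₀ (by positivity)]
    -- By the invariant, `lam * tr T < tr (T H) + 2 ^ t ≤ 2 ^ t * (C + 1)`, with `lam = (C + 1) * 2
    -- ^ m`.
    have h5 : ((C : ℝ) + 1) * ((trace ((T m).proj t)).re * 2 ^ m) ≤ (C + 1) * 2 ^ t := by
      nlinarith
    exact le_of_mul_le_mul_left h5 (by positivity)
  have hlow : ∀ m, δ / 4 ≤ ρ.value (T m) := by
    intro m
    have hTm := hT m
    obtain ⟨lam, hlam⟩ : ∃ lam, lam = (C + 1) * 2 ^ m := ⟨_, rfl⟩
    simp only [← hlam] at hTm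
    -- `M` is so large that the constant `2 * (lam + 2)` of the domination bound is at most half of
    -- `M * δ`.
    obtain ⟨M, hM⟩ := exists_nat_ge (4 * ((lam : ℝ) + 2) / δ)
    rw [div_le_iff₀ hδ] at hM
    have hM0 : (0 : ℝ) < M := by
      rcases Nat.eq_zero_or_pos M with h0 | h0
      · rw [h0, Nat.cast_zero, zero_mul] at hM
        have : (0 : ℝ) ≤ lam := by positivity
        linarith
      · exact_mod_cast h0
    obtain ⟨F, hF, hFcard⟩ := hfail.exists_subset_card_eq M
    have hev : ∀ᶠ t in atTop, ∀ k ∈ F, δ < (trace (ρ.mat t * (S k).proj t)).re := by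
      rw [Filter.eventually_all_finset]
      intro k hk
      exact ((Complex.continuous_re.tendsto _).comp (ρ.tendsto_value (S k))).eventually
        (lt_mem_nhds (hF hk))
    -- The stage is late enough for all of `F` to exceed `δ` and for all of `F` to occur in the
    -- partial sum.
    obtain ⟨t, ht, htF⟩ := (hev.and (eventually_ge_atTop (F.sup id))).exists
    have hsub : F ⊆ Finset.range (t + 1) := fun k hk =>
      Finset.mem_range.2 (Nat.lt_succ_of_le ((Finset.le_sup (f := id) hk).trans htF))
    obtain ⟨-, c, P, hP, hE⟩ := hTm t
    have hdiff : (partialSum S t - ∑ k ∈ F, (S k).proj t).PosSemidef := by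
      have h1 := Finset.sum_sdiff (f := fun k => (S k).proj t) hsub
      rw [partialSum, ← h1, add_sub_cancel_right]
      exact posSemidef_sum_proj S _ t
    have hcard : (((M : ℝ) : ℂ) • (1 : QMat t) - ∑ k ∈ F, (S k).proj t).PosSemidef := by
      have h1 := posSemidef_card_sub_sum_proj S F t
      rwa [hFcard, ← Complex.ofReal_natCast] at h1
    have hmain := trace_re_le_of_domination (lam := (lam : ℝ) + 1) (c := c)
      (posSemidef_sum_proj S F t) hdiff hcard
      ((T m).special t).isHermitian ((T m).special t).isIdempotent hP
      (by rw [Fintype.card_fin]; exact hE)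
      (by rw [Complex.ofReal_add, Complex.ofReal_natCast, Complex.ofReal_one]) (by positivity)
      (ρ.density t).posSemidef (ρ.density t).trace_eq_one
    have hsum : M * δ ≤ (trace (ρ.mat t * ∑ k ∈ F, (S k).proj t)).re := by
      rw [Matrix.mul_sum, trace_sum, Complex.re_sum, ← hFcard, ← nsmul_eq_mul]
      exact Finset.card_nsmul_le_sum _ _ _ fun k hk => (ht k hk).le
    refine le_trans ?_ (ρ.trace_le_value (T m) t)
    by_contra! hlt
    -- If the trace were below `δ / 4`, then `M δ ≤ 2 M tr (ρ T) + 2 (lam + 2) < M δ / 2 + M δ / 2`.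
    nlinarith
  have h1 := hρ T htest
  have h2 : δ / 4 ≤ ⨅ m, ρ.value (T m) := le_ciInf hlow
  linarith

theorem State.IsQSolovayRandom.isQMLRandom {ρ : State} (hρ : ρ.IsQSolovayRandom) :
    ρ.IsQMLRandom := by
  intro S hS
  have hsol : IsQSolovayTest S :=
    ⟨hS.computable, Summable.of_nonneg_of_le (fun k => (tracialState.value_mem_Icc (S k)).1)
      hS.bound (summable_geometric_of_lt_one (by norm_num) (by norm_num))⟩
  have hbdd : BddBelow (Set.range fun m => ρ.value (S m)) :=
    ⟨0, by rintro _ ⟨m, rfl⟩; exact (ρ.value_mem_Icc (S m)).1⟩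
  by_contra hne
  have hpos : 0 < ⨅ m, ρ.value (S m) :=
    lt_of_le_of_ne (le_ciInf fun m => (ρ.value_mem_Icc (S m)).1) (Ne.symm hne)
  refine hρ S hsol _ (half_pos hpos) ?_
  have : {k : ℕ | (⨅ m, ρ.value (S m)) / 2 < ρ.value (S k)} = Set.univ :=
    Set.eq_univ_of_forall fun k => (half_lt_self hpos).trans_le (ciInf_le hbdd k)
  rw [State.FailsSolovayAt, this]
  exact Set.infinite_univ

end QRand

end

theorem theorem2p11 (ρ : QRand.State) : ρ.IsQSolovayRandom ↔ ρ.IsQMLRandom :=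
  ⟨QRand.State.IsQSolovayRandom.isQMLRandom, QRand.State.IsQMLRandom.isQSolovayRandom⟩
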